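/- **Model.** There are $N$ agents. The state space $\mathbb X$ and the measurement spaces $\mathbb Y^i$ are locally compact Polish spaces, and the action spaces $\mathbb U^i$ are finite; $\mathbb Y=\prod_i\mathbb Y^i$, $\mathbb U=\prod_i\mathbb U^i$. The state moves by a transition kernel $\mathcal T(dx'|x,\mathbf u)$, and given $x$ agent $i$ measures $y^i\sim Q^i(dy^i|x)=h^i(x,y^i)\psi^i(dy^i)$, independently over $i$, where $\psi^i$ is a probability measure and $h^i\ge 0$ is measurable. The stage cost $c:\mathbb X\times\mathbb U\to\mathbb R$ is bounded and continuous, $\beta\in(0,1)$, and $K\ge1$ is the sharing period. In period $q$, consisting of the times $qK,\dots,qK+K-1$, a coordinator chooses an action $a_q$, i.e. measurable local maps $f^i_{qK+r}:(y^i_{[qK,qK+r]},u^i_{[qK,qK+r-1]})\mapsto u^i_{qK+r}$, $0\le r<K$, for all agents, which the agents apply to their private information. Actions carry the Young topology: $a_n\to a$ iff for all $i,r$ and all fixed past actions the measures $\psi^i(dy_0)\cdots\psi^i(dy_r)\,\delta_{f^i_{r}(y_{[0,r]},u_{[0,r-1]})}(du)$ converge weakly. **Predictors.** For $\pi\in\mathcal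 P(\mathbb X)$, $\mathbf y\in\mathbb Y$ and $\mathbf u\in\mathbb U$ put $$F(\pi,\mathbf u,\mathbf y)(\cdot)=\frac{\int\mathcal T(\cdot|x,\mathbf u)\prod_ih^i(x,y^i)\,\pi(dx)}{\int\prod_ih^i(x,y^i)\,\pi(dx)},$$ and $F(\pi,\mathbf u,\mathbf y)=\int\mathcal T(\cdot|x,\mathbf u)\,\pi(dx)$ if the denominator is $0$ or $\infty$. For $M\ge0$ let $I^M_q=(\mathbf y_{[(q-M)K,qK-1]},\mathbf u_{[(q-M)K,qK-1]})$ be the window of the last $M$ periods, and let $\pi_q(\pi,I)$ be the result of applying $F$ successively along the window $I$, starting from $\pi$. **Exact process.** Let $\hat Z_q=(\pi_{q-M},I^M_q)$. Given $\hat Z_q=(\pi,I)$ and $a_q=a$, the state $x_{qK}$ has the law $\pi_q(\pi,I)$, the system runs for one period under the local maps $a$, and $\hat Z_{q+1}$ is obtained by updating $\pi$ with the oldest of the $M+1$ periods of data now available and dropping that period from the window. Let $\tilde\theta$ be the transition kernel so defined, and let $$r(\hat Z_q,a)=E\Big[\sum_{t=qK}^{(q+1)K-1}\beta^{t-qK}c(x_t,\mathbf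 u_t)\Big].$$ Let $J(\hat Z)$ be the infimum of $E^\gamma\big[\sum_{q\ge0}\beta^{Kq}r(\hat Z_q,a_q)\big]$ over admissible policies $\gamma$, started from $\hat Z_0=\hat Z$. Admissible policies choose $a_q$ on the basis of $\hat Z_0,\dots,\hat Z_q$, in such a way that the local maps are jointly measurable in this history and the private information. **Sliding-window process.** Fix $\pi^*\in\mathcal P(\mathbb X)$. Let $\hat Z^*_q=(\pi^*,I^M_q)$ be the process with the same cost $r$ in which, given $(\pi^*,I)$ and $a$, the next window is drawn as in $\tilde\theta(\cdot|(\pi^*,I),a)$ and the predictor is reset to $\pi^*$. Let $J_W(\pi^*,I)$ be its optimal value function, over policies admissible for it. **Stability term.** For a law $\nu$ of $\hat Z_0=(\pi_{-M},I^M_0)$ let $$L_q=L_q^M(\nu)=\sup_\gamma E^\gamma_\nu\big[\|\pi_q(\pi_{q-M},I^M_q)-\pi_q(\pi^*,I^M_q)\|_{TV}\big],$$ with the supremum over stationary Markov policies $a_q=\gamma(\hat Z_q)$ of the exact process and $\|\mu-\nu\|_{TV}=2\sup_B|\mu(B)-\nu(B)|$. **Theorem.** Suppose that $\tilde\theta$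 is weak-Feller: for bounded continuous $f$, $\int f\,d\tilde\theta(\cdot|\hat Z,a)$ is continuous in $(\hat Z,a)$, where $\mathcal P(\mathbb X)$ has the weak topology and $\hat Z=(\pi,I)$ ranges over the states for which every denominator along $I$ in the computation of $\pi_q(\pi,I)$ is positive and finite. Suppose also that, from the initial law $\nu$ and under every stationary Markov policy, $\pi_{q-M}\ll\pi^*$ almost surely for all $q\ge 0$. Then $J$ and $J_W$ are Borel measurable, and $$E_\nu\big|J(\hat Z_0)-J_W(\pi^*,I^M_0)\big|\le\frac{\|c\|_\infty}{1-\beta}\sum_{q=0}^\infty\beta^{Kq}L_q^M(\nu).$$ In particular, from every fixed initial state $\hat Z=(\pi,I)$ (that is, $\nu=\delta_{\hat Z}$), $$|J(\hat Z)-J_W(\pi^*,I)|\le\frac{\|c\|_\infty}{1-\beta}\sum_{q=0}^\infty\beta^{Kq}L_q^M(\delta_{\hat Z}).$$ Moreover, if these hypotheses hold for every $M$, with initial laws $\nu_M$, and if $L_q^M(\nu_M)\to0$ as $M\to\infty$ for every $q$, then $E_{\nu_M}|J(\hat Z_0)-J_W(\pi^*,I_0^M)|\to0$ as $M\to\infty$.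 -/

import Mathlib

open MeasureTheory ProbabilityTheory Filter Topology
open scoped ENNReal NNReal BoundedContinuousFunction

noncomputable section

namespace PeriodicSharing

universe u v w

/-! ### The decentralized model -/

/-- The data of one time step seen by the coordinator: measurements and actions of all agents. -/
abbrev Step {N : ℕ} (Y : Fin N → Type v) (U : Fin N → Type w) : Type (max v w) :=
  (∀ i, Y i) × (∀ i, U i)

/-- The measurements and actions of all agents over one sharing period of length `K`. -/
abbrev Block {N : ℕ} (Y : Fin N → Type v) (U : Fin N → Type w) (K : ℕ) : Type (max v w) :=
  Fin K → Step Y U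

/-- A window `I^M` of the last `M` sharing periods, oldest period first. -/
abbrev Window {N : ℕ} (Y : Fin N → Type v) (U : Fin N → Type w) (K M : ℕ) : Type (max v w) :=
  Fin M → Block Y U K

/-- The states `(π_{q-M}, I_q^M)`: a predictor `M` periods ago, and the window since then. -/
abbrev State {N : ℕ} (X : Type u) [MeasurableSpace X] (Y : Fin N → Type v) (U : Fin N → Type w)
    (K M : ℕ) : Type (max u v w) :=
  ProbabilityMeasure X × Window Y U K M

/-- A decentralized stochastic control model with `N` agents: transition kernel `T`, measurement
channels `Q^i(dy|x) = h^i(x,y) ψ^i(dy)`, a bounded continuous stage cost `c` and a discount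
factor `β`. Measurements of different agents are conditionally independent given the state. -/
structure TeamModel {N : ℕ} (X : Type u) (Y : Fin N → Type v) (U : Fin N → Type w)
    [TopologicalSpace X] [MeasurableSpace X] [∀ i, MeasurableSpace (Y i)]
    [∀ i, TopologicalSpace (U i)] [∀ i, MeasurableSpace (U i)] where
  T : Kernel (X × (∀ i, U i)) X
  markov_T : IsMarkovKernel T
  ψ : ∀ i, Measure (Y i)
  prob_ψ : ∀ i, IsProbabilityMeasure (ψ i)
  h : ∀ i, X → Y i → ℝ≥0
  measurable_h : ∀ i, Measurable (Function.uncurry (h i))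
  lintegral_h : ∀ i x, ∫⁻ y, h i x y ∂ψ i = 1
  c : (X × (∀ i, U i)) →ᵇ ℝ
  β : ℝ
  β_pos : 0 < β
  β_lt_one : β < 1

/-- Local maps `f^i_{qK+r} : (y^i_{[qK,qK+r]}, u^i_{[qK,qK+r-1]}) ↦ u^i_{qK+r}`, `0 ≤ r < K`, for
all agents `i`, chosen on the basis of common information in `H`. They are jointly measurable in
the common and the private information. -/
structure DecisionRule {N : ℕ} (Y : Fin N → Type v) (U : Fin N → Type w)
    [∀ i, MeasurableSpace (Y i)] [∀ i, MeasurableSpace (U i)] (K : ℕ)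
    (H : Type*) [MeasurableSpace H] where
  map : ∀ (i : Fin N) (r : Fin K), H → (Fin ((r : ℕ) + 1) → Y i) → (Fin (r : ℕ) → U i) → U i
  measurable_map : ∀ (i : Fin N) (r : Fin K),
    Measurable fun p : H × (Fin ((r : ℕ) + 1) → Y i) × (Fin (r : ℕ) → U i) =>
      map i r p.1 p.2.1 p.2.2

variable {N : ℕ} {X : Type u} {Y : Fin N → Type v} {U : Fin N → Type w}

/-- Use a rule that reads `H` when the available information is `H'`. -/
def DecisionRule.comap [∀ i, MeasurableSpace (Y i)] [∀ i, MeasurableSpace (U i)] {K : ℕ}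
    {H H' : Type*} [MeasurableSpace H] [MeasurableSpace H'] (δ : DecisionRule Y U K H)
    (g : H' → H) (hg : Measurable g) : DecisionRule Y U K H' where
  map i r h := δ.map i r (g h)
  measurable_map i r := (δ.measurable_map i r).comp
    ((hg.comp measurable_fst).prodMk measurable_snd)

/-- The actions of all agents after `r` steps of a period: `d` is the record of `(x, y, u)` over
those steps and `y` the current measurements. Each agent uses only its own past and present. -/
def DecisionRule.act [∀ i, MeasurableSpace (Y i)] [∀ i, MeasurableSpace (U i)] {K : ℕ}
    {H : Type*} [MeasurableSpace H] (δ : DecisionRule Y U K H) (r : ℕ) (hr : r < K) (h : H)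
    (d : Fin r → X × Step Y U) (y : ∀ i, Y i) : ∀ i, U i :=
  fun i => δ.map i ⟨r, hr⟩ h
    (Fin.snoc (α := fun _ => Y i) (fun s => (d s).2.1 i) (y i)) (fun s => (d s).2.2 i)

theorem measurable_snoc {A Ω : Type*} [MeasurableSpace A] [MeasurableSpace Ω] {n : ℕ}
    {f : Ω → Fin n → A} {g : Ω → A} (hf : Measurable f) (hg : Measurable g) :
    Measurable fun ω => (Fin.snoc (α := fun _ => A) (f ω) (g ω) : Fin (n + 1) → A) := by
  refine measurable_pi_lambda _ fun j => ?_
  induction j using Fin.lastCases with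
  | last => simpa using hg
  | cast j =>
    simp only [Fin.snoc_castSucc]
    exact (measurable_pi_apply j).comp hf

theorem DecisionRule.measurable_act [MeasurableSpace X] [∀ i, MeasurableSpace (Y i)]
    [∀ i, MeasurableSpace (U i)] {K : ℕ} {H : Type*} [MeasurableSpace H]
    (δ : DecisionRule Y U K H) (r : ℕ) (hr : r < K) :
    Measurable fun p : H × (Fin r → X × Step Y U) × (∀ i, Y i) =>
      δ.act r hr p.1 p.2.1 p.2.2 := by
  refine measurable_pi_lambda _ fun i => ?_
  have h1 : Measurable fun p : H × (Fin r → X × Step Y U) × (∀ i, Y i) =>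
      fun s : Fin r => (p.2.1 s).2.1 i := by fun_prop
  have h2 : Measurable fun p : H × (Fin r → X × Step Y U) × (∀ i, Y i) => p.2.2 i := by
    fun_prop
  have h3 : Measurable fun p : H × (Fin r → X × Step Y U) × (∀ i, Y i) =>
      fun s : Fin r => (p.2.1 s).2.2 i := by fun_prop
  exact (δ.measurable_map i ⟨r, hr⟩).comp
    (measurable_fst.prodMk ((measurable_snoc h1 h2).prodMk h3))

/-- Append one step `(x, y, u)` to the record. -/
def extend (n : ℕ) (p : ((Fin n → X × Step Y U) × X) × (((∀ i, Y i) × (∀ i, U i)) × X)) :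
    (Fin (n + 1) → X × Step Y U) × X :=
  (Fin.snoc (α := fun _ => X × Step Y U) p.1.1 (p.1.2, p.2.1), p.2.2)

theorem measurable_extend [MeasurableSpace X] [∀ i, MeasurableSpace (Y i)]
    [∀ i, MeasurableSpace (U i)] (n : ℕ) : Measurable (extend (X := X) (Y := Y) (U := U) n) :=
  (measurable_snoc (by fun_prop) (by fun_prop)).prodMk (by fun_prop)

/-- Total variation distance `2 sup_B |μ(B) - ν(B)|`. -/
def tvDist {A : Type*} [MeasurableSpace A] (μ ν : Measure A) : ℝ≥0∞ :=
  2 * ⨆ B : {B : Set A // MeasurableSet B}, ENNReal.ofReal |μ.real B - ν.real B|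

/-- Coordinates for a controlled process whose information state lives in `Z`: `enc` reads the
predictor and the window off a state, `dec` records a new predictor and window as a state. -/
structure InfoState (Z : Type*) [MeasurableSpace Z] (X : Type u) [MeasurableSpace X]
    (Y : Fin N → Type v) (U : Fin N → Type w)
    [∀ i, MeasurableSpace (Y i)] [∀ i, MeasurableSpace (U i)] (K M : ℕ) where
  enc : Z → State X Y U K M
  dec : State X Y U K M → Z
  measurable_enc : Measurable enc
  measurable_dec : Measurable dec

/-- The state `(π_{q-M}, I_q^M)`, with the true predictor. -/
def InfoState.exact (X : Type u) [MeasurableSpace X] (Y : Fin N → Type v) (U : Fin N → Type w)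
    [∀ i, MeasurableSpace (Y i)] [∀ i, MeasurableSpace (U i)] (K M : ℕ) :
    InfoState (State X Y U K M) X Y U K M :=
  ⟨id, id, measurable_id, measurable_id⟩

/-- The state `(π*, I_q^M)`: only the window is kept, and the predictor is always `π*`. -/
def InfoState.sliding (X : Type u) [MeasurableSpace X] (Y : Fin N → Type v) (U : Fin N → Type w)
    [∀ i, MeasurableSpace (Y i)] [∀ i, MeasurableSpace (U i)] (K M : ℕ)
    (πstar : ProbabilityMeasure X) : InfoState (Window Y U K M) X Y U K M :=
  ⟨fun I => (πstar, I), Prod.snd, by fun_prop, measurable_snd⟩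

namespace TeamModel

variable [TopologicalSpace X] [MeasurableSpace X] [∀ i, MeasurableSpace (Y i)]
  [∀ i, TopologicalSpace (U i)] [∀ i, MeasurableSpace (U i)]

section Dynamics

variable (S : TeamModel X Y U)

instance : IsMarkovKernel S.T := S.markov_T

instance (i : Fin N) : IsProbabilityMeasure (S.ψ i) := S.prob_ψ i

/-- The measurement channel of agent `i`. -/
def Q (i : Fin N) : Kernel X (Y i) :=
  Kernel.withDensity (Kernel.const X (S.ψ i)) fun x y => (S.h i x y : ℝ≥0∞)

theorem measurable_h_ennreal (i : Fin N) :
    Measurable (Function.uncurry fun x y => (S.h i x y : ℝ≥0∞)) :=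
  (S.measurable_h i).coe_nnreal_ennreal

instance (i : Fin N) : IsMarkovKernel (S.Q i) where
  isProbabilityMeasure x := ⟨by
    rw [Q, Kernel.withDensity_apply' _ (S.measurable_h_ennreal i)]
    simpa using S.lintegral_h i x⟩

/-- The joint measurement channel `∏ Q^i(dy^i|x)`. -/
def obs : Kernel X (∀ i, Y i) where
  toFun x := Measure.pi fun i => S.Q i x
  measurable' := by
    refine Measurable.measure_of_isPiSystem_of_isProbabilityMeasure generateFrom_pi.symm
      isPiSystem_pi ?_
    rintro _ ⟨s, hs, rfl⟩
    simp only [Measure.pi_pi]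
    exact Finset.measurable_prod _ fun i _ => Kernel.measurable_coe _ (hs i (Set.mem_univ i))

instance : IsMarkovKernel S.obs where
  isProbabilityMeasure x := by
    change IsProbabilityMeasure (Measure.pi fun i => S.Q i x)
    infer_instance

/-- The measurement `y`, the action `u` and the next state `x'`, given the information `h`, the
initial state, the record of the first `n` steps of a period, and the current state `x`. -/
def oneStep {K : ℕ} {H : Type*} [MeasurableSpace H] (δ : DecisionRule Y U K H) (n : ℕ)
    (hn : n < K) :
    Kernel ((H × X) × ((Fin n → X × Step Y U) × X)) (((∀ i, Y i) × (∀ i, U i)) × X) :=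
  ((S.obs.comap (fun p : (H × X) × ((Fin n → X × Step Y U) × X) => p.2.2)
      (measurable_snd.comp measurable_snd)) ⊗ₖ
    (Kernel.deterministic
      (fun p : ((H × X) × ((Fin n → X × Step Y U) × X)) × (∀ i, Y i) =>
        δ.act n hn p.1.1.1 p.1.2.1 p.2)
      ((δ.measurable_act n hn).comp (by fun_prop : Measurable
        fun p : ((H × X) × ((Fin n → X × Step Y U) × X)) × (∀ i, Y i) =>
          (p.1.1.1, p.1.2.1, p.2))))) ⊗ₖ
    (S.T.comap
      (fun p : ((H × X) × ((Fin n → X × Step Y U) × X)) × ((∀ i, Y i) × (∀ i, U i)) =>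
        (p.1.2.2, p.2.2)) (by fun_prop))

instance {K : ℕ} {H : Type*} [MeasurableSpace H] (δ : DecisionRule Y U K H) (n : ℕ)
    (hn : n < K) : IsMarkovKernel (S.oneStep δ n hn) := by
  unfold oneStep; infer_instance

/-- Joint law of the record `(x_s, y_s, u_s)_{s < n}` and of the next state `x_n`, over the first
`n` steps of a period that starts in `x_0`, when the local maps `δ(h)` are applied. -/
def pathKernel {K : ℕ} {H : Type*} [MeasurableSpace H] (δ : DecisionRule Y U K H) :
    (n : ℕ) → n ≤ K → Kernel (H × X) ((Fin n → X × Step Y U) × X)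
  | 0, _ => Kernel.deterministic (fun p => (fun j => Fin.elim0 j, p.2))
      ((measurable_pi_lambda _ fun j => Fin.elim0 j).prodMk measurable_snd)
  | n + 1, hn => (pathKernel δ n (Nat.le_of_succ_le hn) ⊗ₖ S.oneStep δ n hn).map (extend n)

instance {K : ℕ} {H : Type*} [MeasurableSpace H] (δ : DecisionRule Y U K H) (n : ℕ)
    (hn : n ≤ K) : IsMarkovKernel (S.pathKernel δ n hn) := by
  induction n with
  | zero => rw [pathKernel]; infer_instance
  | succ n ih =>
    rw [pathKernel]
    have := ih (Nat.le_of_succ_le hn)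
    exact Kernel.IsMarkovKernel.map _ (measurable_extend n)

/-! ### Bayesian updates of the predictor -/

/-- The likelihood `∏ h^i(x, y^i)`. -/
def lik (x : X) (y : ∀ i, Y i) : ℝ≥0∞ := ((∏ i, S.h i x (y i) : ℝ≥0) : ℝ≥0∞)

theorem measurable_lik : Measurable fun p : X × (∀ i, Y i) => S.lik p.1 p.2 := by
  refine Measurable.coe_nnreal_ennreal (Finset.measurable_prod _ fun i _ => ?_)
  exact (S.measurable_h i).comp
    (measurable_fst.prodMk ((measurable_pi_apply i).comp measurable_snd))

/-- The normalizing constant `∫ ∏ h^i(x, y^i) π(dx)` of Bayes' rule. -/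
def evidence (π : ProbabilityMeasure X) (y : ∀ i, Y i) : ℝ≥0∞ :=
  ∫⁻ x, S.lik x y ∂(π : Measure X)

/-- A probability measure as a kernel. -/
def priorKernel (X : Type u) [MeasurableSpace X] : Kernel (ProbabilityMeasure X) X :=
  ⟨fun π => (π : Measure X), measurable_subtype_coe⟩

instance (X : Type u) [MeasurableSpace X] : IsMarkovKernel (priorKernel X) where
  isProbabilityMeasure π := π.2

theorem measurable_evidence :
    Measurable fun p : ProbabilityMeasure X × (∀ i, Y i) => S.evidence p.1 p.2 := by
  have h : Measurable (Function.uncurry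
      fun (p : ProbabilityMeasure X × (∀ i, Y i)) (x : X) => S.lik x p.2) :=
    S.measurable_lik.comp (by fun_prop : Measurable
      fun q : (ProbabilityMeasure X × (∀ i, Y i)) × X => (q.2, q.1.2))
  exact h.lintegral_kernel_prod_right (κ := (priorKernel X).comap Prod.fst measurable_fst)

/-- Density of the posterior of `x` given `y` with respect to the prior `π`. If the normalizing
constant is `0` or `∞`, the measurement is ignored. -/
def bayesWeight (π : ProbabilityMeasure X) (y : ∀ i, Y i) (x : X) : ℝ≥0∞ :=
  open scoped Classical in
  if S.evidence π y = 0 ∨ S.evidence π y = ∞ then 1 else S.lik x y / S.evidence π y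

theorem measurable_bayesWeight : Measurable (Function.uncurry
    fun (p : ProbabilityMeasure X × Step Y U) (x : X) => S.bayesWeight p.1 p.2.1 x) := by
  have he : Measurable fun q : (ProbabilityMeasure X × Step Y U) × X =>
      S.evidence q.1.1 q.1.2.1 := S.measurable_evidence.comp
    (by fun_prop : Measurable
      fun q : (ProbabilityMeasure X × Step Y U) × X => (q.1.1, q.1.2.1))
  have hl : Measurable fun q : (ProbabilityMeasure X × Step Y U) × X => S.lik q.2 q.1.2.1 :=
    S.measurable_lik.comp (by fun_prop : Measurable
      fun q : (ProbabilityMeasure X × Step Y U) × X => (q.2, q.1.2.1))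
  have hs : MeasurableSet {q : (ProbabilityMeasure X × Step Y U) × X |
      S.evidence q.1.1 q.1.2.1 = 0 ∨ S.evidence q.1.1 q.1.2.1 = ∞} :=
    (he (measurableSet_singleton 0)).union (he (measurableSet_singleton ∞))
  exact Measurable.ite hs measurable_const (hl.div he)

/-- The posterior of `x` given the measurements, as a function of the prior. -/
def posteriorKernel : Kernel (ProbabilityMeasure X × Step Y U) X :=
  Kernel.withDensity ((priorKernel X).comap Prod.fst measurable_fst)
    fun p x => S.bayesWeight p.1 p.2.1 x

instance : IsMarkovKernel S.posteriorKernel where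
  isProbabilityMeasure p := ⟨by
    rw [posteriorKernel, Kernel.withDensity_apply' _ S.measurable_bayesWeight]
    change ∫⁻ x in Set.univ, S.bayesWeight p.1 p.2.1 x ∂(p.1 : Measure X) = 1
    rw [Measure.restrict_univ]
    unfold bayesWeight
    split_ifs with h
    · simp
    · push Not at h
      have hl : Measurable fun x : X => S.lik x p.2.1 :=
        S.measurable_lik.comp (by fun_prop : Measurable fun x : X => (x, p.2.1))
      simp only [div_eq_mul_inv]
      rw [lintegral_mul_const _ hl]
      exact ENNReal.mul_inv_cancel h.1 h.2⟩

/-- The one-step predictor kernel: condition on `y`, then move with `T(·|x,u)`. -/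
def predictKernel : Kernel (ProbabilityMeasure X × Step Y U) X :=
  (S.posteriorKernel ⊗ₖ S.T.comap
    (fun q : (ProbabilityMeasure X × Step Y U) × X => (q.2, q.1.2.2)) (by fun_prop)).snd

instance : IsMarkovKernel S.predictKernel := by
  unfold predictKernel; infer_instance

/-- The one-step update of the predictor. -/
def predict (π : ProbabilityMeasure X) (d : Step Y U) : ProbabilityMeasure X :=
  ⟨S.predictKernel (π, d), inferInstance⟩

theorem measurable_predict :
    Measurable fun p : ProbabilityMeasure X × Step Y U => S.predict p.1 p.2 :=
  S.predictKernel.measurable.subtype_mk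

/-- The predictor after the `n` steps `d 0, …, d (n-1)`. -/
def predictSteps (π : ProbabilityMeasure X) : {n : ℕ} → (Fin n → Step Y U) → ProbabilityMeasure X
  | 0, _ => π
  | _ + 1, d => S.predict (predictSteps π (Fin.init d)) (d (Fin.last _))

theorem measurable_predictSteps (n : ℕ) :
    Measurable fun p : ProbabilityMeasure X × (Fin n → Step Y U) => S.predictSteps p.1 p.2 := by
  induction n with
  | zero => exact measurable_fst
  | succ n ih =>
    refine S.measurable_predict.comp (Measurable.prodMk (ih.comp
      (measurable_fst.prodMk (measurable_pi_lambda _ fun j => ?_))) (by fun_prop))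
    exact (measurable_pi_apply (Fin.castSucc j)).comp measurable_snd

/-- The predictor after the `M` blocks `I 0, …, I (M-1)`: this is `π_q(π_{q-M}, I_q^M)`. -/
def predictWindow {K : ℕ} (π : ProbabilityMeasure X) :
    {M : ℕ} → Window Y U K M → ProbabilityMeasure X
  | 0, _ => π
  | _ + 1, I => S.predictSteps (predictWindow π (Fin.init I)) (I (Fin.last _))

theorem measurable_predictWindow (K M : ℕ) :
    Measurable fun z : State X Y U K M => S.predictWindow z.1 z.2 := by
  induction M with
  | zero => exact measurable_fst
  | succ M ih =>
    refine (S.measurable_predictSteps K).comp (Measurable.prodMk (ih.comp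
      (measurable_fst.prodMk (measurable_pi_lambda _ fun j => ?_))) (by fun_prop))
    exact (measurable_pi_apply (Fin.castSucc j)).comp measurable_snd

/-- Bayes' rule has positive and finite normalizing constants along `d`, from the prior `π`. -/
def StepsPossible (π : ProbabilityMeasure X) {n : ℕ} (d : Fin n → Step Y U) : Prop :=
  ∀ j : Fin n,
    0 < S.evidence (S.predictSteps π fun s : Fin (j : ℕ) => d (s.castLE j.2.le)) (d j).1 ∧
    S.evidence (S.predictSteps π fun s : Fin (j : ℕ) => d (s.castLE j.2.le)) (d j).1 < ∞

/-- The states `(π, I)` whose window `I` is possible under the predictor `π`: the conditional law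
of the current state given the window is defined by Bayes' rule. -/
def possibleStates (K M : ℕ) : Set (State X Y U K M) :=
  {z | ∀ j : Fin M,
    S.StepsPossible (S.predictWindow z.1 fun s : Fin (j : ℕ) => z.2 (s.castLE j.2.le)) (z.2 j)}

/-- The next state when the block `b` is observed in state `z`: the predictor moves on by the
oldest block, which leaves the window, and `b` enters the window. -/
def next {K M : ℕ} (z : State X Y U K M) (b : Block Y U K) : State X Y U K M :=
  let full : Fin (M + 1) → Block Y U K := Fin.snoc (α := fun _ => Block Y U K) z.2 b
  (S.predictSteps z.1 (full 0), fun j => full j.succ)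

theorem measurable_next (K M : ℕ) :
    Measurable fun p : State X Y U K M × Block Y U K => S.next p.1 p.2 := by
  have h : Measurable fun p : State X Y U K M × Block Y U K =>
      (Fin.snoc (α := fun _ => Block Y U K) p.1.2 p.2 : Fin (M + 1) → Block Y U K) :=
    measurable_snoc (by fun_prop) (by fun_prop)
  refine Measurable.prodMk ((S.measurable_predictSteps K).comp
    (Measurable.prodMk (by fun_prop) ((measurable_pi_apply 0).comp h))) ?_
  exact measurable_pi_lambda _ fun j => (measurable_pi_apply j.succ).comp h

/-! ### The controlled process on information states -/

/-- Law of the record `(x, y, u)` over one period, when the state of the system at its beginning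
has the law `π_q(π, I)` and the local maps `δ(h)` are applied. -/
def blockLaw {K M : ℕ} {H : Type*} [MeasurableSpace H] (δ : DecisionRule Y U K H) :
    Kernel (H × State X Y U K M) (Fin K → X × Step Y U) :=
  (((priorKernel X).comap (fun p : H × State X Y U K M => S.predictWindow p.2.1 p.2.2)
      ((S.measurable_predictWindow K M).comp measurable_snd)) ⊗ₖ
    ((S.pathKernel δ K le_rfl).comap
      (fun p : (H × State X Y U K M) × X => (p.1.1, p.2)) (by fun_prop))).map
    fun p => p.2.1

instance {K M : ℕ} {H : Type*} [MeasurableSpace H] (δ : DecisionRule Y U K H) :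
    IsMarkovKernel (S.blockLaw (M := M) δ) :=
  Kernel.IsMarkovKernel.map _ (by fun_prop)

/-- Law of the next state `(π_{q+1-M}, I_{q+1}^M)` given `(π_{q-M}, I_q^M)`. -/
def stepKernel {K M : ℕ} {H : Type*} [MeasurableSpace H] (δ : DecisionRule Y U K H) :
    Kernel (H × State X Y U K M) (State X Y U K M) :=
  (Kernel.id ×ₖ S.blockLaw δ).map
    fun p : (H × State X Y U K M) × (Fin K → X × Step Y U) => S.next p.1.2 fun r => (p.2 r).2

instance {K M : ℕ} {H : Type*} [MeasurableSpace H] (δ : DecisionRule Y U K H) :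
    IsMarkovKernel (S.stepKernel (M := M) δ) := by
  refine Kernel.IsMarkovKernel.map _ ((S.measurable_next K M).comp (Measurable.prodMk ?_ ?_))
  · fun_prop
  · fun_prop

/-- The cost `r((π, I), δ(h))`: expected discounted cost over one period. -/
def stageCost {K M : ℕ} {H : Type*} [MeasurableSpace H] (δ : DecisionRule Y U K H) (h : H)
    (z : State X Y U K M) : ℝ :=
  ∫ ω, ∑ r : Fin K, S.β ^ (r : ℕ) * S.c ((ω r).1, (ω r).2.2) ∂(S.blockLaw δ (h, z))

section Control

variable {K M : ℕ} {Z : Type*} [MeasurableSpace Z] (E : InfoState Z X Y U K M)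

/-- An admissible policy: in period `q` the local maps depend on the states of periods
`0, …, q`. -/
abbrev _root_.PeriodicSharing.Policy (Y : Fin N → Type v) (U : Fin N → Type w)
    [∀ i, MeasurableSpace (Y i)] [∀ i, MeasurableSpace (U i)] (K : ℕ)
    (Z : Type*) [MeasurableSpace Z] :=
  ∀ q : ℕ, DecisionRule Y U K (Fin (q + 1) → Z)

/-- The stationary Markov policy that applies `δ(z_q)` in every period `q`. -/
def _root_.PeriodicSharing.DecisionRule.stationary (δ : DecisionRule Y U K Z) :
    Policy Y U K Z :=
  fun q => δ.comap (fun g => g (Fin.last q)) (by fun_prop)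

/-- Conditional law of `z_{q+1}` given `z_0, …, z_q`. -/
def transition (γ : Policy Y U K Z) (q : ℕ) : Kernel (Fin (q + 1) → Z) Z :=
  ((S.stepKernel (γ q)).comap (fun g => (g, E.enc (g (Fin.last q))))
    (measurable_id.prodMk (E.measurable_enc.comp (measurable_pi_apply _)))).map E.dec

instance (γ : Policy Y U K Z) (q : ℕ) : IsMarkovKernel (S.transition E γ q) :=
  Kernel.IsMarkovKernel.map _ E.measurable_dec

/-- Joint law of `z_0, …, z_q` under the policy `γ` when `z_0` has the law `ν`. -/
def historyLaw (γ : Policy Y U K Z) (ν : Measure Z) : (q : ℕ) → Measure (Fin (q + 1) → Z)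
  | 0 => ν.map fun z _ => z
  | q + 1 => ((historyLaw γ ν q) ⊗ₘ (S.transition E γ q)).map
      fun p => Fin.snoc (α := fun _ => Z) p.1 p.2

/-- Law of `z_q`. -/
def stateLaw (γ : Policy Y U K Z) (ν : Measure Z) (q : ℕ) : Measure Z :=
  (S.historyLaw E γ ν q).map fun g => g (Fin.last q)

/-- Expected total discounted cost, with discount factor `β^K` per period, from `z`. -/
def cost (γ : Policy Y U K Z) (z : Z) : ℝ :=
  ∑' q : ℕ, S.β ^ (K * q) *
    ∫ g, S.stageCost (γ q) g (E.enc (g (Fin.last q))) ∂(S.historyLaw E γ (Measure.dirac z) q)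

/-- The optimal value function. -/
def value (z : Z) : ℝ := ⨅ γ : Policy Y U K Z, S.cost E γ z

end Control

/-- The value function `J` of the process `(π_{q-M}, I_q^M)`. -/
def J (K M : ℕ) (z : State X Y U K M) : ℝ := S.value (InfoState.exact X Y U K M) z

/-- The value function `J_W` of the sliding-window process `(π*, I_q^M)`. -/
def JW (K M : ℕ) (πstar : ProbabilityMeasure X) (I : Window Y U K M) : ℝ :=
  S.value (InfoState.sliding X Y U K M πstar) I

/-- Law of `(π_{q-M}, I_q^M)` under the stationary Markov policy `δ`, from the initial law `ν`. -/
def trueLaw {K M : ℕ} (δ : DecisionRule Y U K (State X Y U K M))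
    (ν : Measure (State X Y U K M)) (q : ℕ) : Measure (State X Y U K M) :=
  S.stateLaw (InfoState.exact X Y U K M) δ.stationary ν q

/-- `L_q`: the supremum over stationary Markov policies of the expected total variation distance
between the true predictor `π_q(π_{q-M}, I_q^M)` and the mismatched one `π_q(π*, I_q^M)`. -/
def L {K M : ℕ} (πstar : ProbabilityMeasure X) (ν : Measure (State X Y U K M)) (q : ℕ) : ℝ≥0∞ :=
  ⨆ δ : DecisionRule Y U K (State X Y U K M),
    ∫⁻ z, tvDist (S.predictWindow z.1 z.2 : Measure X) (S.predictWindow πstar z.2 : Measure X)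
      ∂(S.trueLaw δ ν q)

/-- At every period `q`, `π_{q-M} ≪ π*` almost surely. -/
def PredictorsAC {K M : ℕ} (πstar : ProbabilityMeasure X) (ν : Measure (State X Y U K M)) :
    Prop :=
  ∀ (δ : DecisionRule Y U K (State X Y U K M)) (q : ℕ),
    ∀ᵐ z ∂(S.trueLaw δ ν q), (z.1 : Measure X) ≪ (πstar : Measure X)

end Dynamics

/-! ### The weak Feller property -/

/-- The actions of the coordinator: local maps of all agents over one period. -/
def Action (_S : TeamModel X Y U) (K : ℕ) := DecisionRule Y U K Unit

/-- The measure `ψ(dy_0) ⋯ ψ(dy_r) f^i_r(du | y_{[0,r]}, u_{[0,r-1]})` for fixed past actions. -/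
def youngMeasure (S : TeamModel X Y U) {K : ℕ} (a : S.Action K) (i : Fin N) (r : Fin K)
    (past : Fin (r : ℕ) → U i) : ProbabilityMeasure ((Fin ((r : ℕ) + 1) → Y i) × U i) :=
  ⟨(Measure.pi fun _ => S.ψ i).map fun y => (y, DecisionRule.map a i r () y past),
    Measure.isProbabilityMeasure_map (Measurable.aemeasurable (measurable_id.prodMk
      ((DecisionRule.measurable_map a i r).comp
        (measurable_const.prodMk (measurable_id.prodMk measurable_const)))))⟩

section Feller

variable [∀ i, TopologicalSpace (Y i)]
  [∀ i, SecondCountableTopology (Y i)] [∀ i, OpensMeasurableSpace (Y i)]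
  [∀ i, OpensMeasurableSpace (U i)] [OpensMeasurableSpace X]

/-- The Young topology on actions: weak convergence of all the measures `youngMeasure`. -/
instance (S : TeamModel X Y U) (K : ℕ) : TopologicalSpace (S.Action K) :=
  TopologicalSpace.induced
    (fun a => fun k : Σ (i : Fin N) (r : Fin K), (Fin (r : ℕ) → U i) =>
      S.youngMeasure a k.1 k.2.1 k.2.2)
    Pi.topologicalSpace

/-- The kernel of `((π_{q-M}, I_q^M), a_q)` is weak Feller: its integral of every bounded
continuous function is continuous in the state and the action. States whose window is impossible
under their predictor, where the kernel is not determined by Bayes' rule, are left out. -/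
def WeakFeller (S : TeamModel X Y U) (K M : ℕ) : Prop :=
  ∀ f : State X Y U K M →ᵇ ℝ,
    ContinuousOn
      (fun p : State X Y U K M × S.Action K =>
        ∫ z, f z ∂(S.stepKernel (M := M) (H := Unit) p.2 ((), p.1)))
      (S.possibleStates K M ×ˢ Set.univ)

end Feller

end TeamModel

end PeriodicSharing

end

noncomputable section

namespace PeriodicSharing

universe u v w

/-! ### Countable families of maps that are dense in measure -/

/-! Both value functions are the bounded measurable solutions of their Bellman equations
(`value_spec`), so they can be compared one period at a time. Fix an action and compare the two
right-hand sides at $(\pi,I)$ and $(\pi^*,I)$. Two things differ. The system starts the period from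
two different predictors, and since the sliding-window cost-to-go is bounded by
$\|c\|_\infty/(1-\beta)$, this costs at most that constant times the total variation distance of the
predictors. The continuation values also differ, but only by $\beta^K$ times the gap $|J-J_W|$ at
the next exact state, because both processes see the same new window
(`abs_integral_costToGo_sub_le`).

Taking infima over actions therefore bounds the gap by the mismatch plus $\beta^K$ times the
supremum over actions of the expected next gap. A single measurable stationary rule nearly attains
this supremum at every state (`exists_rule_gap_le`). Iterating the inequality along the exact
process under that rule, the mismatch in period $q$ averages to at most $L_q$ by definition of the
supremum, and the remaining gap is killed by $\beta^{Kn}$ (`lintegral_gap_le_of_nonempty`).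

The delicate point is measurability, since the infima run over an uncountable set of rules and the
selected actions must depend measurably on the state. Two rules induce the same law on the records
along which they agree (`restrict_blockLaw_agree`), so expected costs at a fixed state depend
continuously on the local maps in measure. One countable family of actions is dense in measure for
all laws of the record at once (`exists_dense_actions`). Infima thus become countable, and nearly
optimal actions are selected by the first good index. -/

/-- Maps into a finite set are approximated in measure, for every finite measure at once, by a
countable family of measurable maps. -/
theorem exists_countable_dense_maps (A : Type*) (B : Type*) [MeasurableSpace A]
    [MeasurableSpace.CountablyGenerated A] [Finite B] [Nonempty B] [MeasurableSpace B]
    [MeasurableSingletonClass B] :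
    ∃ D : Set (A → B), D.Countable ∧ D.Nonempty ∧ (∀ g ∈ D, Measurable g) ∧
      ∀ (μ : Measure A) [IsFiniteMeasure μ] (f : A → B), Measurable f → ∀ ε : ℝ, 0 < ε →
        ∃ g ∈ D, μ {a | g a ≠ f a} ≤ ENNReal.ofReal ε := by
  classical
  have := Fintype.ofFinite B
  set 𝒜 : Set (Set A) :=
    generateSetAlgebra (MeasurableSpace.countableGeneratingSet A) with h𝒜
  have h𝒜c : 𝒜.Countable :=
    countable_generateSetAlgebra MeasurableSpace.countable_countableGeneratingSet
  have h𝒜g : ‹MeasurableSpace A› = MeasurableSpace.generateFrom 𝒜 := by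
    rw [h𝒜, generateFrom_generateSetAlgebra_eq,
      MeasurableSpace.generateFrom_countableGeneratingSet]
  have h𝒜m : ∀ s ∈ 𝒜, MeasurableSet s := fun s hs => by
    rw [h𝒜g]; exact MeasurableSpace.measurableSet_generateFrom hs
  -- A map is coded by one set of the countable algebra for each value; `sel` decodes a membership
  -- pattern, with an arbitrary value when no set contains the point. The code does not involve the
  -- measure, so one family serves all measures.
  let sel : (B → Prop) → B := fun p => if h : ∃ b, p b then h.choose else Classical.arbitrary B
  let mk : (B → 𝒜) → A → B := fun s a => sel fun b => a ∈ (s b : Set A)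
  have : Countable 𝒜 := h𝒜c.to_subtype
  have hne : Nonempty (B → 𝒜) := ⟨fun _ => ⟨∅, isSetAlgebra_generateSetAlgebra.empty_mem⟩⟩
  refine ⟨Set.range mk, Set.countable_range _, Set.range_nonempty _, ?_, ?_⟩
  · rintro _ ⟨s, rfl⟩
    have h1 : Measurable fun a => fun b => a ∈ (s b : Set A) :=
      measurable_pi_lambda _ fun b => measurable_to_prop (by
        simpa [Set.preimage, Set.mem_singleton_iff] using h𝒜m _ (s b).2)
    exact (measurable_of_countable sel).comp h1
  · intro μ _ f hf ε hε
    have hd : μ.MeasureDense 𝒜 := Measure.MeasureDense.of_generateFrom_isSetAlgebra_finite μ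
      isSetAlgebra_generateSetAlgebra h𝒜g
    have hc : (0 : ℝ) < Fintype.card B := by exact_mod_cast Fintype.card_pos
    choose t ht hμt using fun b : B => hd.approx (f ⁻¹' {b}) (hf (measurableSet_singleton b))
      (measure_ne_top _ _) (ε / Fintype.card B) (by positivity)
    refine ⟨_, ⟨fun b => ⟨t b, ht b⟩, rfl⟩, ?_⟩
    -- Off the symmetric differences, `a ∈ t b` holds exactly for `b = f a`, so the decoder has no
    -- freedom left.
    have hsub : {a | mk (fun b => ⟨t b, ht b⟩) a ≠ f a} ⊆
        ⋃ b : B, symmDiff (f ⁻¹' {b}) (t b) := by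
      intro a ha
      by_contra hcon
      simp only [Set.mem_iUnion, not_exists, Set.mem_symmDiff, Set.mem_preimage,
        Set.mem_singleton_iff, not_or, not_and, not_not] at hcon
      refine ha ?_
      have hex : ∃ b, a ∈ t b := ⟨f a, (hcon (f a)).1 rfl⟩
      have : mk (fun b => ⟨t b, ht b⟩) a = hex.choose := dif_pos hex
      rw [this]
      exact ((hcon _).2 hex.choose_spec).symm
    calc μ {a | mk (fun b => ⟨t b, ht b⟩) a ≠ f a}
        ≤ ∑ b : B, μ (symmDiff (f ⁻¹' {b}) (t b)) :=
          (measure_mono hsub).trans (measure_iUnion_fintype_le _ _)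
      _ ≤ ∑ _b : B, ENNReal.ofReal (ε / Fintype.card B) :=
          Finset.sum_le_sum fun b _ => (hμt b).le
      _ = ENNReal.ofReal ε := by
          rw [Finset.sum_const, ← ENNReal.ofReal_nsmul, Finset.card_univ, nsmul_eq_mul,
            mul_div_cancel₀ _ hc.ne']

variable {N : ℕ} {X : Type u} {Y : Fin N → Type v} {U : Fin N → Type w}

/-! ### Coupling of two rules

For a fixed state, the law of the block is continuous in total variation with respect to
convergence of the local maps in measure. Hence infima over all actions are infima over a countable
family, and nearly optimal actions can be selected measurably, without continuity in the state. -/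

section Coupling

variable [∀ i, MeasurableSpace (Y i)] [∀ i, MeasurableSpace (U i)] {K : ℕ}
  {H H' : Type*} [MeasurableSpace H] [MeasurableSpace H']

/-- Two rules prescribe the same actions all along a record. -/
def DecisionRule.Agree (δ : DecisionRule Y U K H) (δ' : DecisionRule Y U K H') (h : H) (h' : H')
    {n : ℕ} (hn : n ≤ K) (d : Fin n → X × Step Y U) : Prop :=
  ∀ r : Fin n,
    δ.act r (r.2.trans_le hn) h (fun s : Fin r => d (s.castLE r.2.le)) (d r).2.1 =
      δ'.act r (r.2.trans_le hn) h' (fun s : Fin r => d (s.castLE r.2.le)) (d r).2.1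

theorem DecisionRule.agree_snoc (δ : DecisionRule Y U K H) (δ' : DecisionRule Y U K H')
    (h : H) (h' : H') {n : ℕ} (hn : n + 1 ≤ K) (d : Fin n → X × Step Y U)
    (e : X × Step Y U) :
    δ.Agree δ' h h' hn (Fin.snoc (α := fun _ => X × Step Y U) d e) ↔
      δ.Agree δ' h h' (Nat.le_of_succ_le hn) d ∧
        δ.act n hn h d e.2.1 = δ'.act n hn h' d e.2.1 := by
  unfold DecisionRule.Agree
  rw [Fin.forall_fin_succ']
  refine and_congr (forall_congr' fun r => ?_) ?_
  · have : (fun s : Fin (r.castSucc : ℕ) => (Fin.snoc (α := fun _ => X × Step Y U) d e :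
        Fin (n + 1) → X × Step Y U) (s.castLE r.castSucc.2.le)) =
        fun s : Fin r => d (s.castLE r.2.le) := by
      funext s
      exact Fin.snoc_castSucc (α := fun _ => X × Step Y U) e d (Fin.castLE r.2.le s)
    rw [this, Fin.snoc_castSucc]
    rfl
  · have : (fun s : Fin (Fin.last n : ℕ) => (Fin.snoc (α := fun _ => X × Step Y U) d e :
        Fin (n + 1) → X × Step Y U) (s.castLE (Fin.last n).2.le)) = d := by
      funext s
      exact Fin.snoc_castSucc (α := fun _ => X × Step Y U) e d s
    rw [this, Fin.snoc_last]
    rfl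

theorem DecisionRule.measurableSet_agree [MeasurableSpace X] [∀ i, Countable (U i)]
    [∀ i, MeasurableSingletonClass (U i)]
    (δ : DecisionRule Y U K H) (δ' : DecisionRule Y U K H') (h : H) (h' : H') {n : ℕ}
    (hn : n ≤ K) : MeasurableSet {d : Fin n → X × Step Y U | δ.Agree δ' h h' hn d} := by
  simp only [DecisionRule.Agree, Set.ofPred_forall]
  refine MeasurableSet.iInter fun r => ?_
  have hm : Measurable fun d : Fin n → X × Step Y U =>
      ((fun s : Fin r => d (s.castLE r.2.le)), (d r).2.1) :=
    (measurable_pi_lambda _ fun s => measurable_pi_apply _).prodMk (by fun_prop)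
  exact measurableSet_eq_fun
    ((δ.measurable_act r _).comp (measurable_const.prodMk hm))
    ((δ'.measurable_act r _).comp (measurable_const.prodMk hm))

end Coupling

namespace TeamModel

variable [TopologicalSpace X] [MeasurableSpace X] [∀ i, MeasurableSpace (Y i)]
  [∀ i, TopologicalSpace (U i)] [∀ i, MeasurableSpace (U i)]

variable (S : TeamModel X Y U)

section Coupling

variable {K : ℕ} {H H' : Type*} [MeasurableSpace H] [MeasurableSpace H']

theorem lintegral_oneStep (δ : DecisionRule Y U K H) {n : ℕ} (hn : n < K)
    (p : (H × X) × ((Fin n → X × Step Y U) × X))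
    {f : ((∀ i, Y i) × (∀ i, U i)) × X → ℝ≥0∞} (hf : Measurable f) :
    ∫⁻ q, f q ∂(S.oneStep δ n hn p) =
      ∫⁻ y, ∫⁻ x, f ((y, δ.act n hn p.1.1 p.2.1 y), x)
        ∂(S.T (p.2.2, δ.act n hn p.1.1 p.2.1 y)) ∂(S.obs p.2.2) := by
  have hm : Measurable fun b : (∀ i, Y i) × (∀ i, U i) =>
      ∫⁻ x, f (b, x) ∂(S.T (p.2.2, b.2)) :=
    Measurable.lintegral_kernel_prod_right (κ := S.T.comap
      (fun b : (∀ i, Y i) × (∀ i, U i) => (p.2.2, b.2)) (by fun_prop))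
      (f := fun b x => f (b, x)) hf
  rw [oneStep, Kernel.lintegral_compProd _ _ _ hf]
  simp only [Kernel.comap_apply]
  rw [Kernel.lintegral_compProd _ _ _ hm]
  refine lintegral_congr fun y => ?_
  exact Kernel.lintegral_deterministic' _ (hm.comp measurable_prodMk_left)

variable [∀ i, Countable (U i)] [∀ i, MeasurableSingletonClass (U i)]

/-- Two rules induce the same law on the records along which they agree. -/
theorem lintegral_pathKernel_indicator_agree (δ : DecisionRule Y U K H)
    (δ' : DecisionRule Y U K H') (h : H) (h' : H') (x : X) {n : ℕ} (hn : n ≤ K)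
    {f : (Fin n → X × Step Y U) × X → ℝ≥0∞} (hf : Measurable f) :
    ∫⁻ q, {q : (Fin n → X × Step Y U) × X | δ.Agree δ' h h' hn q.1}.indicator f q
        ∂(S.pathKernel δ n hn (h, x)) =
      ∫⁻ q, {q : (Fin n → X × Step Y U) × X | δ.Agree δ' h h' hn q.1}.indicator f q
        ∂(S.pathKernel δ' n hn (h', x)) := by
  classical
  induction n with
  | zero =>
    rw [pathKernel, pathKernel]
    rw [Kernel.deterministic_apply, Kernel.deterministic_apply]
  | succ n ih =>
    have hm : MeasurableSet {q : (Fin (n + 1) → X × Step Y U) × X | δ.Agree δ' h h' hn q.1} :=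
      (δ.measurableSet_agree (X := X) δ' h h' hn).preimage measurable_fst
    have hn' := Nat.le_of_succ_le hn
    -- Agreement on `n + 1` steps factors into agreement on the first `n` and agreement at the last
    -- one. `g` absorbs the second factor, leaving the first to the induction hypothesis.
    let g : (Fin n → X × Step Y U) × X → ((∀ i, Y i) × (∀ i, U i)) × X → ℝ≥0∞ := fun q e =>
      if δ.act n hn h q.1 e.1.1 = δ'.act n hn h' q.1 e.1.1 then f (extend n (q, e)) else 0
    have hg : Measurable (Function.uncurry g) := by
      refine Measurable.ite (measurableSet_eq_fun ?_ ?_) (hf.comp (measurable_extend n))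
        measurable_const
      · exact (δ.measurable_act n hn).comp (by fun_prop : Measurable
          fun p : ((Fin n → X × Step Y U) × X) × (((∀ i, Y i) × (∀ i, U i)) × X) =>
            (h, p.1.1, p.2.1.1))
      · exact (δ'.measurable_act n hn).comp (by fun_prop : Measurable
          fun p : ((Fin n → X × Step Y U) × X) × (((∀ i, Y i) × (∀ i, U i)) × X) =>
            (h', p.1.1, p.2.1.1))
    have hg' : ∀ q, Measurable (g q) := fun q => hg.comp (measurable_prodMk_left (x := q))
    have hF : ∀ q e, {q : (Fin (n + 1) → X × Step Y U) × X | δ.Agree δ' h h' hn q.1}.indicator f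
        (extend n (q, e)) = {q : (Fin n → X × Step Y U) × X |
          δ.Agree δ' h h' hn' q.1}.indicator 1 q * g q e := by
      intro q e
      have := δ.agree_snoc δ' h h' hn q.1 (q.2, e.1)
      simp only [Set.indicator, Set.mem_ofPred_eq, extend, g, this, Pi.one_apply]
      by_cases h1 : δ.Agree δ' h h' hn' q.1
      · simp [h1]
      · simp [h1]
    -- Where the current actions coincide the one-step laws are the same, and elsewhere `g`
    -- vanishes.
    have hswap : ∀ q, ∫⁻ e, g q e ∂(S.oneStep δ n hn ((h, x), q)) =
        ∫⁻ e, g q e ∂(S.oneStep δ' n hn ((h', x), q)) := by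
      intro q
      rw [S.lintegral_oneStep δ hn _ (hg' q), S.lintegral_oneStep δ' hn _ (hg' q)]
      refine lintegral_congr fun y => ?_
      by_cases hy : δ.act n hn h q.1 y = δ'.act n hn h' q.1 y
      · simp only [hy]
      · simp [g, hy]
    have hi : Measurable fun q => ∫⁻ e, g q e ∂(S.oneStep δ n hn ((h, x), q)) :=
      Measurable.lintegral_kernel_prod_right (κ := (S.oneStep δ n hn).comap
        (fun q => ((h, x), q)) measurable_prodMk_left) hg
    have key := ih hn' hi
    have hind : ∀ q, {q : (Fin n → X × Step Y U) × X | δ.Agree δ' h h' hn' q.1}.indicator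
        (fun q => ∫⁻ e, g q e ∂(S.oneStep δ n hn ((h, x), q))) q =
        {q : (Fin n → X × Step Y U) × X | δ.Agree δ' h h' hn' q.1}.indicator 1 q *
          ∫⁻ e, g q e ∂(S.oneStep δ n hn ((h, x), q)) := fun q => by
      simp [Set.indicator]
    simp only [hind] at key
    have hm2 : Measurable fun p => {q : (Fin (n + 1) → X × Step Y U) × X |
        δ.Agree δ' h h' hn q.1}.indicator f (extend n p) :=
      (hf.indicator hm).comp (measurable_extend n)
    rw [pathKernel, pathKernel, Kernel.lintegral_map _ (measurable_extend n) _ (hf.indicator hm),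
      Kernel.lintegral_map _ (measurable_extend n) _ (hf.indicator hm),
      Kernel.lintegral_compProd _ _ _ hm2, Kernel.lintegral_compProd _ _ _ hm2]
    simp only [hF]
    simp_rw [lintegral_const_mul _ (hg' _)]
    rw [key]
    simp only [hswap]

end Coupling

end TeamModel

/-- Two probability measures that coincide on a set integrate a bounded function alike, up to the
mass of the complement. -/
theorem abs_integral_sub_le_of_restrict_eq {A : Type*} [MeasurableSpace A] {μ μ' : Measure A}
    [IsProbabilityMeasure μ] [IsProbabilityMeasure μ'] {G : Set A} (hG : MeasurableSet G)
    (h : μ.restrict G = μ'.restrict G) {f : A → ℝ} (hf : Measurable f) {C : ℝ}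
    (hC : ∀ a, |f a| ≤ C) :
    |∫ a, f a ∂μ - ∫ a, f a ∂μ'| ≤ 2 * C * μ.real Gᶜ := by
  have hi : ∀ ρ : Measure A, IsProbabilityMeasure ρ → Integrable f ρ := fun ρ _ =>
    Integrable.of_bound hf.aestronglyMeasurable C (Eventually.of_forall hC)
  have hGG : μ.real G = μ'.real G := by
    have := congrArg (fun ρ : Measure A => ρ.real Set.univ) h
    simpa [measureReal_restrict_apply] using this
  -- Equal masses on `G` force equal masses off `G`. Each of the two integrals over the complement
  -- then contributes at most `C` times that mass.
  have hGc : μ'.real Gᶜ = μ.real Gᶜ := by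
    rw [probReal_compl_eq_one_sub hG, probReal_compl_eq_one_sub hG, hGG]
  have hb : ∀ ρ : Measure A, IsProbabilityMeasure ρ → |∫ a in Gᶜ, f a ∂ρ| ≤ C * ρ.real Gᶜ :=
    fun ρ _ => by
      simpa only [Real.norm_eq_abs] using norm_setIntegral_le_of_norm_le_const (f := f)
        (measure_lt_top ρ Gᶜ) fun a _ => hC a
  rw [← integral_add_compl hG (hi μ inferInstance), ← integral_add_compl hG (hi μ' inferInstance),
    h]
  have h1 := abs_le.1 (hb μ inferInstance)
  have h2 := abs_le.1 (hb μ' inferInstance)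
  rw [hGc] at h2
  rw [abs_le]
  constructor <;> linarith [h1.1, h1.2, h2.1, h2.2]

/-- A countable family of actions that is dense in measure, for every law of the record. -/
theorem exists_dense_actions [MeasurableSpace X] [∀ i, MeasurableSpace (Y i)]
    [∀ i, StandardBorelSpace (Y i)] [∀ i, MeasurableSpace (U i)]
    [∀ i, Finite (U i)] [∀ i, Nonempty (U i)] [∀ i, MeasurableSingletonClass (U i)] (K : ℕ) :
    ∃ a : ℕ → DecisionRule Y U K Unit, ∀ (δ : DecisionRule Y U K Unit)
      (μ : Measure (Fin K → X × Step Y U)) [IsFiniteMeasure μ] (ε : ℝ), 0 < ε →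
      ∃ k, μ {d | ¬ δ.Agree (a k) () () le_rfl d} ≤ ENNReal.ofReal ε := by
  choose D hDc hDn hDm hD using fun (i : Fin N) (r : Fin K) =>
    exists_countable_dense_maps ((Fin ((r : ℕ) + 1) → Y i) × (Fin (r : ℕ) → U i)) (U i)
  have hc : ∀ i r, Countable (D i r) := fun i r => (hDc i r).to_subtype
  have hn : Nonempty (∀ i r, D i r) := ⟨fun i r => ⟨_, (hDn i r).some_mem⟩⟩
  obtain ⟨e, he⟩ := exists_surjective_nat (∀ i r, D i r)
  refine ⟨fun k => ⟨fun i r _ y u => (e k i r : _ → U i) (y, u), fun i r =>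
    (hDm i r _ (e k i r).2).comp measurable_snd⟩, fun δ μ _ ε hε => ?_⟩
  -- Private information of agent `i` at step `r`. Pushing `μ` forward along it reduces the density
  -- of rules to that of maps into a finite set.
  let info : ∀ (i : Fin N) (r : Fin K), (Fin K → X × Step Y U) →
      (Fin ((r : ℕ) + 1) → Y i) × (Fin (r : ℕ) → U i) := fun i r d =>
    (Fin.snoc (α := fun _ => Y i) (fun s : Fin (r : ℕ) => (d (s.castLE r.2.le)).2.1 i)
      ((d r).2.1 i), fun s : Fin (r : ℕ) => (d (s.castLE r.2.le)).2.2 i)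
  have hinfo : ∀ i r, Measurable (info i r) := fun i r =>
    (measurable_snoc (measurable_pi_lambda _ fun s => by fun_prop) (by fun_prop)).prodMk
      (measurable_pi_lambda _ fun s => by fun_prop)
  -- There are `N * K` local maps to approximate; the added one keeps the denominator positive when
  -- `N` or `K` is zero.
  have hη : 0 < ε / (N * K + 1) := by positivity
  choose g hgD hg using fun (i : Fin N) (r : Fin K) => hD i r (μ.map (info i r))
    (fun p => δ.map i r () p.1 p.2)
    ((δ.measurable_map i r).comp (measurable_const.prodMk measurable_id)) _ hη
  obtain ⟨k, hk⟩ := he fun i r => ⟨g i r, hgD i r⟩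
  refine ⟨k, ?_⟩
  have hsub : {d : Fin K → X × Step Y U | ¬ δ.Agree (⟨fun i r _ y u => (e k i r : _ → U i) (y, u),
      fun i r => (hDm i r _ (e k i r).2).comp measurable_snd⟩ : DecisionRule Y U K Unit)
        () () le_rfl d} ⊆ ⋃ i, ⋃ r, info i r ⁻¹' {p | g i r p ≠ δ.map i r () p.1 p.2} := by
    intro d hd
    by_contra hcon
    simp only [Set.mem_iUnion, not_exists, Set.mem_preimage, Set.mem_ofPred_eq, not_not] at hcon
    refine hd fun r => funext fun i => ?_
    have := hcon i r
    simp only [hk, DecisionRule.act]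
    exact this.symm
  have hm : ∀ (i : Fin N) (r : Fin K), MeasurableSet
      {p : (Fin ((r : ℕ) + 1) → Y i) × (Fin (r : ℕ) → U i) | g i r p ≠ δ.map i r () p.1 p.2} := fun i r =>
    (measurableSet_eq_fun (hDm i r _ (hgD i r))
      ((δ.measurable_map i r).comp (measurable_const.prodMk measurable_id))).compl
  calc _ ≤ μ (⋃ i, ⋃ r, info i r ⁻¹' {p | g i r p ≠ δ.map i r () p.1 p.2}) := measure_mono hsub
    _ ≤ ∑ i, ∑ r, μ (info i r ⁻¹' {p | g i r p ≠ δ.map i r () p.1 p.2}) :=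
        (measure_iUnion_fintype_le _ _).trans
          (Finset.sum_le_sum fun i _ => measure_iUnion_fintype_le _ _)
    _ ≤ ∑ _i : Fin N, ∑ _r : Fin K, ENNReal.ofReal (ε / (N * K + 1)) :=
        Finset.sum_le_sum fun i _ => Finset.sum_le_sum fun r _ => by
          rw [← Measure.map_apply (hinfo i r) (hm i r)]
          exact hg i r
    _ ≤ ENNReal.ofReal ε := by
        simp only [Finset.sum_const, Finset.card_univ, Fintype.card_fin]
        rw [← ENNReal.ofReal_nsmul, ← ENNReal.ofReal_nsmul]
        refine ENNReal.ofReal_le_ofReal ?_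
        rw [nsmul_eq_mul, nsmul_eq_mul, ← mul_assoc, mul_div_assoc', div_le_iff₀ (by positivity)]
        nlinarith

namespace TeamModel

variable [TopologicalSpace X] [MeasurableSpace X] [∀ i, MeasurableSpace (Y i)]
  [∀ i, TopologicalSpace (U i)] [∀ i, MeasurableSpace (U i)]

variable (S : TeamModel X Y U) {K M : ℕ} {H H' : Type*} [MeasurableSpace H] [MeasurableSpace H']

theorem lintegral_blockLaw (δ : DecisionRule Y U K H) (h : H) (z : State X Y U K M)
    {f : (Fin K → X × Step Y U) → ℝ≥0∞} (hf : Measurable f) :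
    ∫⁻ d, f d ∂(S.blockLaw δ (h, z)) =
      ∫⁻ x, ∫⁻ q, f q.1 ∂(S.pathKernel δ K le_rfl (h, x))
        ∂(S.predictWindow z.1 z.2 : Measure X) := by
  rw [blockLaw, Kernel.lintegral_map _ (by fun_prop) _ hf,
    Kernel.lintegral_compProd _ _ _ (by fun_prop)]
  rfl

variable [∀ i, Countable (U i)] [∀ i, MeasurableSingletonClass (U i)]

/-- Two rules induce the same law of the block on the records along which they agree. -/
theorem restrict_blockLaw_agree (δ : DecisionRule Y U K H) (δ' : DecisionRule Y U K H')
    (h : H) (h' : H') (z : State X Y U K M) :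
    (S.blockLaw δ (h, z)).restrict {d | δ.Agree δ' h h' le_rfl d} =
      (S.blockLaw δ' (h', z)).restrict {d | δ.Agree δ' h h' le_rfl d} := by
  have hm := δ.measurableSet_agree (X := X) δ' h h' le_rfl
  ext B hB
  rw [Measure.restrict_apply hB, Measure.restrict_apply hB,
    ← lintegral_indicator_one (hB.inter hm), ← lintegral_indicator_one (hB.inter hm),
    S.lintegral_blockLaw δ h z (measurable_one.indicator (hB.inter hm)),
    S.lintegral_blockLaw δ' h' z (measurable_one.indicator (hB.inter hm))]
  refine lintegral_congr fun x => ?_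
  have := S.lintegral_pathKernel_indicator_agree δ δ' h h' x le_rfl
    (f := fun q => B.indicator 1 q.1) ((measurable_one.indicator hB).comp measurable_fst)
  convert! this using 3 with q <;>
  · rw [Set.inter_comm, ← Set.indicator_indicator]
    rfl

/-- Rules with the same local maps agree along every record, so the restricted laws are the full
ones. This replaces a stationary, frozen or glued rule by the action it prescribes at the current
information. -/
theorem blockLaw_congr (δ : DecisionRule Y U K H) (δ' : DecisionRule Y U K H')
    {h : H} {h' : H'} (hh : ∀ i r, δ.map i r h = δ'.map i r h') (z : State X Y U K M) :
    S.blockLaw δ (h, z) = S.blockLaw δ' (h', z) := by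
  have := S.restrict_blockLaw_agree δ δ' h h' z
  have hu : {d : Fin K → X × Step Y U | δ.Agree δ' h h' le_rfl d} = Set.univ := by
    refine Set.eq_univ_of_forall fun d r => ?_
    funext i
    simp only [DecisionRule.act, hh]
  simpa [hu] using this

/-- This is the continuity in the action: the error is a disagreement probability under the law of
`δ` alone, which the dense family makes small. -/
theorem abs_integral_blockLaw_sub_le (δ : DecisionRule Y U K H) (δ' : DecisionRule Y U K H')
    (h : H) (h' : H') (z : State X Y U K M) {f : (Fin K → X × Step Y U) → ℝ}
    (hf : Measurable f) {C : ℝ} (hC : ∀ d, |f d| ≤ C) :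
    |∫ d, f d ∂(S.blockLaw δ (h, z)) - ∫ d, f d ∂(S.blockLaw δ' (h', z))| ≤
      2 * C * (S.blockLaw δ (h, z)).real {d | ¬ δ.Agree δ' h h' le_rfl d} :=
  abs_integral_sub_le_of_restrict_eq (δ.measurableSet_agree (X := X) δ' h h' le_rfl)
    (S.restrict_blockLaw_agree δ δ' h h' z) hf hC

end TeamModel

/-- The action that the rule `δ` prescribes when the common information is `h`. -/
def DecisionRule.freeze [∀ i, MeasurableSpace (Y i)] [∀ i, MeasurableSpace (U i)] {K : ℕ}
    {H : Type*} [MeasurableSpace H] (δ : DecisionRule Y U K H) (h : H) :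
    DecisionRule Y U K Unit :=
  δ.comap (fun _ => h) measurable_const

/-! ### Infima over actions and measurable selection -/

namespace TeamModel

variable [TopologicalSpace X] [MeasurableSpace X] [∀ i, MeasurableSpace (Y i)]
  [∀ i, TopologicalSpace (U i)] [∀ i, MeasurableSpace (U i)]

variable (S : TeamModel X Y U) {K M : ℕ} {Z : Type*}

/-- Infimum over all actions of the expectation of `G z` over the record of the next period, from
the information state `e z`. -/
def blockInf (e : Z → State X Y U K M) (G : Z → (Fin K → X × Step Y U) → ℝ) (z : Z) : ℝ :=
  ⨅ δ : DecisionRule Y U K Unit, ∫ d, G z d ∂(S.blockLaw δ ((), e z))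

theorem integrable_blockLaw {H : Type*} [MeasurableSpace H] (δ : DecisionRule Y U K H) (h : H)
    (z : State X Y U K M) {f : (Fin K → X × Step Y U) → ℝ} (hf : Measurable f) {C : ℝ}
    (hC : ∀ d, |f d| ≤ C) : Integrable f (S.blockLaw δ (h, z)) :=
  Integrable.of_bound hf.aestronglyMeasurable C (Eventually.of_forall hC)

theorem abs_integral_blockLaw_le {H : Type*} [MeasurableSpace H] (δ : DecisionRule Y U K H)
    (h : H) (z : State X Y U K M) {f : (Fin K → X × Step Y U) → ℝ} {C : ℝ}
    (hC : ∀ d, |f d| ≤ C) : |∫ d, f d ∂(S.blockLaw δ (h, z))| ≤ C := by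
  simpa using norm_integral_le_of_norm_le_const (μ := S.blockLaw δ (h, z)) (f := f) (C := C)
    (Eventually.of_forall hC)

theorem bddBelow_blockInf (e : Z → State X Y U K M) {G : Z → (Fin K → X × Step Y U) → ℝ} {C : ℝ}
    (hC : ∀ z d, |G z d| ≤ C) (z : Z) :
    BddBelow (Set.range fun δ : DecisionRule Y U K Unit =>
      ∫ d, G z d ∂(S.blockLaw δ ((), e z))) :=
  ⟨-C, by
    rintro _ ⟨δ, rfl⟩
    exact (abs_le.1 (S.abs_integral_blockLaw_le δ () (e z) (hC z))).1⟩

theorem abs_blockInf_le [Nonempty (DecisionRule Y U K Unit)] (e : Z → State X Y U K M)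
    {G : Z → (Fin K → X × Step Y U) → ℝ} {C : ℝ} (hC : ∀ z d, |G z d| ≤ C) (z : Z) :
    |S.blockInf e G z| ≤ C := by
  refine abs_le.2 ⟨le_ciInf fun δ => (abs_le.1 (S.abs_integral_blockLaw_le δ () (e z) (hC z))).1,
    (ciInf_le (S.bddBelow_blockInf e hC z) (Classical.arbitrary _)).trans
      (abs_le.1 (S.abs_integral_blockLaw_le _ () (e z) (hC z))).2⟩

/-- The infimum over all actions depends on the integrand in a nonexpansive way. -/
theorem abs_blockInf_sub_le [Nonempty (DecisionRule Y U K Unit)] (e : Z → State X Y U K M)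
    {G G' : Z → (Fin K → X × Step Y U) → ℝ} {C B : ℝ} (hG : ∀ z, Measurable (G z))
    (hG' : ∀ z, Measurable (G' z)) (hC : ∀ z d, |G z d| ≤ C) (hC' : ∀ z d, |G' z d| ≤ C)
    (hB : ∀ z d, |G z d - G' z d| ≤ B) (z : Z) :
    |S.blockInf e G z - S.blockInf e G' z| ≤ B := by
  have key : ∀ δ : DecisionRule Y U K Unit, |∫ d, G z d ∂(S.blockLaw δ ((), e z)) -
      ∫ d, G' z d ∂(S.blockLaw δ ((), e z))| ≤ B := fun δ => by
    rw [← integral_sub (S.integrable_blockLaw δ () (e z) (hG z) (hC z))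
      (S.integrable_blockLaw δ () (e z) (hG' z) (hC' z))]
    exact S.abs_integral_blockLaw_le δ () (e z) (hB z)
  rw [abs_sub_le_iff]
  constructor
  · rw [sub_le_comm]
    refine le_ciInf fun δ => ?_
    have := ciInf_le (S.bddBelow_blockInf e hC z) δ
    have h2 := (abs_le.1 (key δ)).2
    unfold blockInf
    linarith
  · rw [sub_le_comm]
    refine le_ciInf fun δ => ?_
    have := ciInf_le (S.bddBelow_blockInf e hC' z) δ
    have h2 := (abs_le.1 (key δ)).1
    unfold blockInf
    linarith

theorem measurable_integral_blockLaw [MeasurableSpace Z] {e : Z → State X Y U K M} (he : Measurable e)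
    {G : Z → (Fin K → X × Step Y U) → ℝ} (hG : Measurable (Function.uncurry G))
    (δ : DecisionRule Y U K Unit) :
    Measurable fun z => ∫ d, G z d ∂(S.blockLaw δ ((), e z)) :=
  (StronglyMeasurable.integral_kernel_prod_right
    (κ := (S.blockLaw δ).comap (fun z : Z => ((), e z)) (measurable_const.prodMk he))
    hG.stronglyMeasurable).measurable

variable [∀ i, Finite (U i)] [∀ i, MeasurableSingletonClass (U i)]

/-- For fixed common information a rule is just an action, so reading more history cannot beat the
infimum over actions. -/
theorem blockInf_le (e : Z → State X Y U K M) {G : Z → (Fin K → X × Step Y U) → ℝ} {C : ℝ}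
    (hC : ∀ z d, |G z d| ≤ C) {H : Type*} [MeasurableSpace H] (δ : DecisionRule Y U K H) (h : H)
    (z : Z) : S.blockInf e G z ≤ ∫ d, G z d ∂(S.blockLaw δ (h, e z)) := by
  rw [S.blockLaw_congr δ (δ.freeze h) (h' := ()) (fun _ _ => rfl)]
  exact ciInf_le (S.bddBelow_blockInf e hC z) (δ.freeze h)

variable [∀ i, StandardBorelSpace (Y i)] [∀ i, Nonempty (U i)]

/-- The infimum over all actions is the infimum over a countable family of actions. -/
theorem exists_blockInf_eq_iInf_nat (X : Type u) [TopologicalSpace X] [MeasurableSpace X]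
    (Y : Fin N → Type v) (U : Fin N → Type w) [∀ i, MeasurableSpace (Y i)]
    [∀ i, TopologicalSpace (U i)] [∀ i, MeasurableSpace (U i)] [∀ i, Finite (U i)]
    [∀ i, MeasurableSingletonClass (U i)] [∀ i, StandardBorelSpace (Y i)] [∀ i, Nonempty (U i)]
    (K M : ℕ) (Z : Type*) :
    ∃ a : ℕ → DecisionRule Y U K Unit, ∀ (S : TeamModel X Y U) (e : Z → State X Y U K M)
      (G : Z → (Fin K → X × Step Y U) → ℝ) (C : ℝ), (∀ z, Measurable (G z)) →
      (∀ z d, |G z d| ≤ C) → ∀ z,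
      S.blockInf e G z = ⨅ k, ∫ d, G z d ∂(S.blockLaw (a k) ((), e z)) := by
  obtain ⟨a, ha⟩ := exists_dense_actions (X := X) (Y := Y) (U := U) K
  refine ⟨a, fun S e G C hG hC z => ?_⟩
  have : Nonempty (DecisionRule Y U K Unit) := ⟨a 0⟩
  refine le_antisymm (le_ciInf fun k => ciInf_le (S.bddBelow_blockInf e hC z) _)
    (le_ciInf fun δ => le_of_forall_pos_le_add fun ε hε => ?_)
  have hbdd : BddBelow (Set.range fun k => ∫ d, G z d ∂(S.blockLaw (a k) ((), e z))) :=
    (S.bddBelow_blockInf e hC z).mono (by rintro _ ⟨k, rfl⟩; exact ⟨a k, rfl⟩)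
  -- The disagreement probability enters with the factor `2 * |C|`; the added one avoids division by
  -- zero when `C = 0`.
  obtain ⟨k, hk⟩ := ha δ (S.blockLaw δ ((), e z)) (ε / (2 * |C| + 1)) (by positivity)
  have h1 := S.abs_integral_blockLaw_sub_le δ (a k) () () (e z) (hG z)
    (fun d => (hC z d).trans (le_abs_self C))
  have h2 : (S.blockLaw δ ((), e z)).real {d | ¬ δ.Agree (a k) () () le_rfl d} ≤
      ε / (2 * |C| + 1) := ENNReal.toReal_le_of_le_ofReal (by positivity) hk
  have h3 : 2 * |C| * (ε / (2 * |C| + 1)) ≤ ε := by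
    rw [mul_div_assoc', div_le_iff₀ (by positivity)]
    nlinarith [abs_nonneg C]
  have h4 := mul_le_mul_of_nonneg_left h2 (by positivity : 0 ≤ 2 * |C|)
  linarith [ciInf_le hbdd k, (abs_le.1 h1).1]

theorem measurable_blockInf [MeasurableSpace Z] {e : Z → State X Y U K M} (he : Measurable e)
    {G : Z → (Fin K → X × Step Y U) → ℝ} (hG : Measurable (Function.uncurry G)) {C : ℝ}
    (hC : ∀ z d, |G z d| ≤ C) : Measurable (S.blockInf e G) := by
  obtain ⟨a, ha⟩ := exists_blockInf_eq_iInf_nat X Y U K M Z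
  rw [funext (ha S e G C (fun z => hG.comp measurable_prodMk_left) hC)]
  exact Measurable.iInf fun k => S.measurable_integral_blockLaw he hG (a k)

/-- Measurable selection of nearly optimal actions. -/
theorem exists_rule_integral_le_blockInf [MeasurableSpace Z] {e : Z → State X Y U K M} (he : Measurable e)
    {G : Z → (Fin K → X × Step Y U) → ℝ} (hG : Measurable (Function.uncurry G)) {C : ℝ}
    (hC : ∀ z d, |G z d| ≤ C) {ε : ℝ} (hε : 0 < ε) :
    ∃ δ : DecisionRule Y U K Z, ∀ z,
      ∫ d, G z d ∂(S.blockLaw δ (z, e z)) ≤ S.blockInf e G z + ε := by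
  classical
  obtain ⟨a, ha⟩ := exists_blockInf_eq_iInf_nat X Y U K M Z
  have hex : ∀ z, ∃ k, ∫ d, G z d ∂(S.blockLaw (a k) ((), e z)) < S.blockInf e G z + ε := by
    intro z
    rw [ha S e G C (fun z => hG.comp measurable_prodMk_left) hC]
    exact exists_lt_of_ciInf_lt (lt_add_of_pos_right _ hε)
  -- The first index that is good at `z` depends measurably on `z`, and gluing actions along a
  -- countable index keeps them jointly measurable in `z` and the private information.
  have hfind := measurable_find hex fun k =>
    measurableSet_lt (S.measurable_integral_blockLaw he hG (a k))
      ((S.measurable_blockInf he hG hC).add_const ε)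
  let δ : DecisionRule Y U K Z :=
    ⟨fun i r z => (a (Nat.find (hex z))).map i r (), fun i r => by
      have h1 : Measurable fun p : ℕ × (Fin ((r : ℕ) + 1) → Y i) × (Fin (r : ℕ) → U i) =>
          (a p.1).map i r () p.2.1 p.2.2 :=
        measurable_from_prod_countable_right fun k =>
          ((a k).measurable_map i r).comp (measurable_const.prodMk measurable_id)
      exact h1.comp ((hfind.comp measurable_fst).prodMk measurable_snd)⟩
  refine ⟨δ, fun z => ?_⟩
  rw [S.blockLaw_congr δ (a (Nat.find (hex z))) (h' := ()) fun _ _ => rfl]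
  exact (Nat.find_spec (hex z)).le

end TeamModel

namespace TeamModel

variable [TopologicalSpace X] [MeasurableSpace X] [∀ i, MeasurableSpace (Y i)]
  [∀ i, TopologicalSpace (U i)] [∀ i, MeasurableSpace (U i)]

variable (S : TeamModel X Y U) {K M : ℕ} {Z : Type*}

/-! ### The Bellman equation -/

/-- Discounted cost of a record over one period. -/
def blockCost (d : Fin K → X × Step Y U) : ℝ :=
  ∑ r : Fin K, S.β ^ (r : ℕ) * S.c ((d r).1, (d r).2.2)

/-- Bound on the total discounted cost. -/
def costBound : ℝ := ‖S.c‖ / (1 - S.β)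

theorem costBound_nonneg : 0 ≤ S.costBound :=
  div_nonneg (norm_nonneg _) (sub_nonneg.2 S.β_lt_one.le)

theorem β_pow_nonneg (n : ℕ) : 0 ≤ S.β ^ n := pow_nonneg S.β_pos.le n

theorem β_pow_lt_one (hK : 0 < K) : S.β ^ K < 1 :=
  pow_lt_one₀ S.β_pos.le S.β_lt_one hK.ne'

/-- The factor `1 - S.β ^ K` of the geometric sum is kept because it makes the ball of radius
`S.costBound` invariant: the cost of one period plus `S.β ^ K * S.costBound` is at most
`S.costBound`. -/
theorem abs_blockCost_le (d : Fin K → X × Step Y U) :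
    |S.blockCost d| ≤ S.costBound * (1 - S.β ^ K) := by
  have h1 : (0 : ℝ) < 1 - S.β := sub_pos.2 S.β_lt_one
  calc |S.blockCost d| ≤ ∑ r : Fin K, |S.β ^ (r : ℕ) * S.c ((d r).1, (d r).2.2)| :=
        Finset.abs_sum_le_sum_abs _ _
    _ ≤ ∑ r : Fin K, S.β ^ (r : ℕ) * ‖S.c‖ := Finset.sum_le_sum fun r _ => by
        rw [abs_mul, abs_of_nonneg (S.β_pow_nonneg _)]
        exact mul_le_mul_of_nonneg_left (S.c.norm_coe_le_norm _) (S.β_pow_nonneg _)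
    _ = S.costBound * (1 - S.β ^ K) := by
        rw [← Finset.sum_mul, Fin.sum_univ_eq_sum_range (fun r => S.β ^ r),
          geom_sum_eq S.β_lt_one.ne, costBound, ← neg_sub, ← neg_sub 1 S.β, neg_div_neg_eq]
        ring

theorem measurable_blockCost [OpensMeasurableSpace (X × (∀ i, U i))] :
    Measurable (S.blockCost (K := K)) :=
  Finset.measurable_sum _ fun r _ => (S.c.continuous.measurable.comp (by fun_prop :
    Measurable fun d : Fin K → X × Step Y U => ((d r).1, (d r).2.2))).const_mul _

variable [MeasurableSpace Z] (E : InfoState Z X Y U K M)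

/-- The information state that follows `z` when `d` is the record of the period. -/
def nextState (z : Z) (d : Fin K → X × Step Y U) : Z :=
  E.dec (S.next (E.enc z) fun r => (d r).2)

theorem measurable_nextState : Measurable (Function.uncurry (S.nextState E)) :=
  E.measurable_dec.comp ((S.measurable_next K M).comp
    ((E.measurable_enc.comp measurable_fst).prodMk (by fun_prop)))

/-- Cost of a record plus discounted value of the information state that it leads to. -/
def costToGo (V : Z → ℝ) (z : Z) (d : Fin K → X × Step Y U) : ℝ :=
  S.blockCost d + S.β ^ K * V (S.nextState E z d)

theorem measurable_costToGo [OpensMeasurableSpace (X × (∀ i, U i))] {V : Z → ℝ}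
    (hV : Measurable V) : Measurable (Function.uncurry (S.costToGo E V)) :=
  (S.measurable_blockCost.comp measurable_snd).add
    ((hV.comp (S.measurable_nextState E)).const_mul _)

theorem abs_costToGo_le {V : Z → ℝ} (hV : ∀ z, |V z| ≤ S.costBound) (z : Z)
    (d : Fin K → X × Step Y U) : |S.costToGo E V z d| ≤ S.costBound := by
  have h1 := S.abs_blockCost_le d
  have h2 := mul_le_mul_of_nonneg_left (hV (S.nextState E z d)) (S.β_pow_nonneg K)
  calc |S.costToGo E V z d| ≤ |S.blockCost d| + |S.β ^ K * V (S.nextState E z d)| :=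
        abs_add_le _ _
    _ ≤ S.costBound := by
        rw [abs_mul, abs_of_nonneg (S.β_pow_nonneg K)]
        linarith

/-- The dynamic programming operator. -/
def bellman (V : Z → ℝ) : Z → ℝ := S.blockInf E.enc (S.costToGo E V)

variable [OpensMeasurableSpace (X × (∀ i, U i))] [∀ i, Nonempty (U i)]

instance : Nonempty (DecisionRule Y U K Unit) :=
  ⟨⟨fun _ _ _ _ _ => Classical.arbitrary _, fun _ _ => measurable_const⟩⟩

/-- Contraction with modulus `S.β ^ K`, stated with pointwise bounds so that it applies directly to
iterates and their pointwise limit. -/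
theorem abs_bellman_sub_le {V V' : Z → ℝ} (hV : Measurable V) (hV' : Measurable V')
    (hb : ∀ z, |V z| ≤ S.costBound) (hb' : ∀ z, |V' z| ≤ S.costBound) {B : ℝ}
    (hB : ∀ z, |V z - V' z| ≤ B) (z : Z) :
    |S.bellman E V z - S.bellman E V' z| ≤ S.β ^ K * B := by
  refine S.abs_blockInf_sub_le E.enc
    (fun z => (S.measurable_costToGo E hV).comp measurable_prodMk_left)
    (fun z => (S.measurable_costToGo E hV').comp measurable_prodMk_left)
    (S.abs_costToGo_le E hb) (S.abs_costToGo_le E hb') (fun z d => ?_) z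
  change |(_ + _ * V _) - (_ + _ * V' _)| ≤ _
  rw [add_sub_add_left_eq_sub, ← mul_sub, abs_mul,
    abs_of_nonneg (S.β_pow_nonneg K)]
  exact mul_le_mul_of_nonneg_left (hB _) (S.β_pow_nonneg K)

variable [∀ i, Finite (U i)] [∀ i, MeasurableSingletonClass (U i)]
  [∀ i, StandardBorelSpace (Y i)]

theorem measurable_bellman {V : Z → ℝ} (hV : Measurable V) (hb : ∀ z, |V z| ≤ S.costBound) :
    Measurable (S.bellman E V) :=
  S.measurable_blockInf E.measurable_enc (S.measurable_costToGo E hV) (S.abs_costToGo_le E hb)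

/-- The Bellman equation has a bounded measurable solution. -/
theorem exists_bellman_eq (hK : 0 < K) :
    ∃ V : Z → ℝ, Measurable V ∧ (∀ z, |V z| ≤ S.costBound) ∧ S.bellman E V = V := by
  -- Value iteration from zero. The limit is taken pointwise, which preserves measurability, while
  -- the geometric rate is uniform in the state.
  let W : ℕ → Z → ℝ := fun n => (S.bellman E)^[n] 0
  have hW : ∀ n, W (n + 1) = S.bellman E (W n) := fun n => Function.iterate_succ_apply' _ _ _
  have hprop : ∀ n, Measurable (W n) ∧ ∀ z, |W n z| ≤ S.costBound := by
    intro n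
    induction n with
    | zero => exact ⟨measurable_const, fun z => by simpa [W] using S.costBound_nonneg⟩
    | succ n ih =>
      rw [hW]
      exact ⟨S.measurable_bellman E ih.1 ih.2,
        S.abs_blockInf_le E.enc (S.abs_costToGo_le E ih.2)⟩
  have hstep : ∀ n z, |W n z - W (n + 1) z| ≤ S.costBound * (S.β ^ K) ^ n := by
    intro n
    induction n with
    | zero => intro z; simpa [W] using (hprop 1).2 z
    | succ n ih =>
      intro z
      rw [hW (n + 1), hW n]
      calc _ ≤ S.β ^ K * (S.costBound * (S.β ^ K) ^ n) :=
            S.abs_bellman_sub_le E (hprop n).1 (hW n ▸ (hprop (n + 1)).1) (hprop n).2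
              (hW n ▸ (hprop (n + 1)).2) (hW n ▸ ih) z
        _ = _ := by ring
  have hρ := S.β_pow_lt_one hK
  have hdist : ∀ z n, dist (W n z) (W (n + 1) z) ≤ S.costBound * (S.β ^ K) ^ n :=
    fun z n => hstep n z
  choose V hV using fun z =>
    cauchySeq_tendsto_of_complete (cauchySeq_of_le_geometric _ _ hρ (hdist z))
  have hVm : Measurable V :=
    measurable_of_tendsto_metrizable (fun n => (hprop n).1) (tendsto_pi_nhds.2 hV)
  have hVb : ∀ z, |V z| ≤ S.costBound := fun z =>
    le_of_tendsto (hV z).abs (Eventually.of_forall fun n => (hprop n).2 z)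
  have hVW : ∀ n z, |V z - W n z| ≤ S.costBound * (S.β ^ K) ^ n / (1 - S.β ^ K) := fun n z => by
    rw [abs_sub_comm]
    exact dist_le_of_le_geometric_of_tendsto _ _ hρ (hdist z) (hV z) n
  refine ⟨V, hVm, hVb, funext fun z => ?_⟩
  -- The contraction estimate carries the uniform rate through the Bellman operator.
  have hlim : Tendsto (fun n => W (n + 1) z) atTop (𝓝 (S.bellman E V z)) := by
    rw [tendsto_iff_dist_tendsto_zero]
    have h0 : Tendsto (fun n => S.β ^ K * (S.costBound * (S.β ^ K) ^ n / (1 - S.β ^ K))) atTop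
        (𝓝 0) := by
      have := tendsto_pow_atTop_nhds_zero_of_lt_one (S.β_pow_nonneg K) hρ
      simpa using ((this.const_mul S.costBound).div_const (1 - S.β ^ K)).const_mul (S.β ^ K)
    refine squeeze_zero (fun _ => dist_nonneg) (fun n => ?_) h0
    rw [hW, dist_comm, Real.dist_eq]
    exact S.abs_bellman_sub_le E hVm (hprop n).1 hVb (hprop n).2 (hVW n) z
  exact tendsto_nhds_unique hlim ((hV z).comp (tendsto_add_atTop_nat 1))

end TeamModel

/-- Iterating a discounted one-step inequality. -/
theorem le_tsum_of_le_add_mul {v c : ℕ → ℝ} {ρ ε B : ℝ} (hρ0 : 0 ≤ ρ) (hρ1 : ρ < 1)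
    (hv : ∀ q, |v q| ≤ B) (hc : ∀ q, |c q| ≤ B) (h : ∀ q, v q ≤ c q + ρ * v (q + 1) + ε) :
    v 0 ≤ ∑' q, ρ ^ q * c q + ε / (1 - ρ) := by
  have hgeo := hasSum_geometric_of_lt_one hρ0 hρ1
  have hs : Summable fun q => ρ ^ q * c q := by
    refine Summable.of_norm_bounded (hgeo.summable.mul_right B) fun q => ?_
    rw [Real.norm_eq_abs, abs_mul, abs_of_nonneg (pow_nonneg hρ0 q)]
    exact mul_le_mul_of_nonneg_left (hc q) (pow_nonneg hρ0 q)
  -- After `n` unrollings the remainder is `ρ ^ n * v n`, which vanishes because `v` is bounded; the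
  -- errors `ε` add up geometrically.
  have hfin : ∀ n, v 0 ≤ ∑ q ∈ Finset.range n, ρ ^ q * c q + ρ ^ n * v n +
      ε * ∑ q ∈ Finset.range n, ρ ^ q := by
    intro n
    induction n with
    | zero => simp
    | succ n ih =>
      have := mul_le_mul_of_nonneg_left (h n) (pow_nonneg hρ0 n)
      rw [Finset.sum_range_succ, Finset.sum_range_succ, pow_succ]
      linarith
  have hvn : Tendsto (fun n => ρ ^ n * v n) atTop (𝓝 0) := by
    refine squeeze_zero_norm (a := fun n => ρ ^ n * B) (fun n => ?_) (by
      simpa using (tendsto_pow_atTop_nhds_zero_of_lt_one hρ0 hρ1).mul_const B)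
    rw [Real.norm_eq_abs, abs_mul, abs_of_nonneg (pow_nonneg hρ0 n)]
    exact mul_le_mul_of_nonneg_left (hv n) (pow_nonneg hρ0 n)
  have hlim := (hs.hasSum.tendsto_sum_nat.add hvn).add (hgeo.tendsto_sum_nat.const_mul ε)
  rw [add_zero, ← div_eq_mul_inv] at hlim
  exact ge_of_tendsto hlim (Eventually.of_forall hfin)

theorem measurable_apply_last {Z β : Type*} [MeasurableSpace Z] [MeasurableSpace β] {V : Z → β}
    (hV : Measurable V) (q : ℕ) : Measurable fun g : Fin (q + 1) → Z => V (g (Fin.last q)) :=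
  hV.comp (measurable_pi_apply _)

namespace TeamModel

variable [TopologicalSpace X] [MeasurableSpace X] [∀ i, MeasurableSpace (Y i)]
  [∀ i, TopologicalSpace (U i)] [∀ i, MeasurableSpace (U i)]

variable (S : TeamModel X Y U) {K M : ℕ} {Z : Type*} [MeasurableSpace Z]
  (E : InfoState Z X Y U K M)

/-! ### Histories under a policy -/

theorem stepKernel_apply {H : Type*} [MeasurableSpace H] (δ : DecisionRule Y U K H) (h : H)
    (z : State X Y U K M) :
    S.stepKernel δ (h, z) = (S.blockLaw δ (h, z)).map fun d => S.next z fun r => (d r).2 := by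
  have hm : Measurable fun p : (H × State X Y U K M) × (Fin K → X × Step Y U) =>
      S.next p.1.2 fun r => (p.2 r).2 :=
    (S.measurable_next K M).comp (Measurable.prodMk (by fun_prop) (by fun_prop))
  rw [stepKernel, Kernel.map_apply _ hm, Kernel.prod_apply, Kernel.id_apply, Measure.dirac_prod,
    Measure.map_map hm measurable_prodMk_left]
  rfl

theorem measurable_nextState_right (z : Z) : Measurable (S.nextState E z) :=
  (S.measurable_nextState E).comp measurable_prodMk_left

theorem transition_apply (γ : Policy Y U K Z) (q : ℕ) (g : Fin (q + 1) → Z) :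
    S.transition E γ q g = (S.blockLaw (γ q) (g, E.enc (g (Fin.last q)))).map
      (S.nextState E (g (Fin.last q))) := by
  rw [transition, Kernel.map_apply _ E.measurable_dec, Kernel.comap_apply, stepKernel_apply,
    Measure.map_map E.measurable_dec]
  · rfl
  · exact (S.measurable_next K M).comp (Measurable.prodMk (by fun_prop) (by fun_prop))

instance (γ : Policy Y U K Z) (ν : Measure Z) [IsProbabilityMeasure ν] (q : ℕ) :
    IsProbabilityMeasure (S.historyLaw E γ ν q) := by
  induction q with
  | zero => exact Measure.isProbabilityMeasure_map (by fun_prop)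
  | succ q ih =>
    rw [historyLaw]
    exact Measure.isProbabilityMeasure_map
      (measurable_snoc (by fun_prop) (by fun_prop)).aemeasurable

theorem integral_historyLaw_succ (γ : Policy Y U K Z) (ν : Measure Z) [IsProbabilityMeasure ν]
    (q : ℕ) {V : Z → ℝ} (hV : Measurable V) {C : ℝ} (hC : ∀ z, |V z| ≤ C) :
    ∫ g, V (g (Fin.last (q + 1))) ∂(S.historyLaw E γ ν (q + 1)) =
      ∫ g, ∫ d, V (S.nextState E (g (Fin.last q)) d)
        ∂(S.blockLaw (γ q) (g, E.enc (g (Fin.last q)))) ∂(S.historyLaw E γ ν q) := by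
  have hs : Measurable fun p : (Fin (q + 1) → Z) × Z =>
      (Fin.snoc (α := fun _ => Z) p.1 p.2 : Fin (q + 2) → Z) :=
    measurable_snoc (by fun_prop) (by fun_prop)
  rw [historyLaw, integral_map hs.aemeasurable
    (measurable_apply_last hV _).aestronglyMeasurable]
  have hV2 : Measurable fun p : (Fin (q + 1) → Z) × Z => V p.2 := hV.comp measurable_snd
  simp only [Fin.snoc_last]
  rw [Measure.integral_compProd (Integrable.of_bound
    hV2.aestronglyMeasurable C (Eventually.of_forall fun p => hC p.2))]
  refine integral_congr_ae (Eventually.of_forall fun g => ?_)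
  simp only
  rw [transition_apply, integral_map
    (S.measurable_nextState_right E _).aemeasurable
    hV.aestronglyMeasurable]

theorem lintegral_stateLaw_succ (γ : Policy Y U K Z) (ν : Measure Z) [IsProbabilityMeasure ν]
    (q : ℕ) {V : Z → ℝ≥0∞} (hV : Measurable V) :
    ∫⁻ z, V z ∂(S.stateLaw E γ ν (q + 1)) =
      ∫⁻ g, ∫⁻ d, V (S.nextState E (g (Fin.last q)) d)
        ∂(S.blockLaw (γ q) (g, E.enc (g (Fin.last q)))) ∂(S.historyLaw E γ ν q) := by
  have hs : Measurable fun p : (Fin (q + 1) → Z) × Z =>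
      (Fin.snoc (α := fun _ => Z) p.1 p.2 : Fin (q + 2) → Z) :=
    measurable_snoc (by fun_prop) (by fun_prop)
  rw [stateLaw, lintegral_map hV (measurable_pi_apply _), historyLaw,
    lintegral_map (measurable_apply_last hV _) hs]
  have hV2 : Measurable fun p : (Fin (q + 1) → Z) × Z => V p.2 := hV.comp measurable_snd
  simp only [Fin.snoc_last]
  rw [Measure.lintegral_compProd hV2]
  refine lintegral_congr fun g => ?_
  rw [transition_apply, lintegral_map hV (S.measurable_nextState_right E _)]

theorem stateLaw_zero (γ : Policy Y U K Z) (ν : Measure Z) : S.stateLaw E γ ν 0 = ν := by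
  rw [stateLaw, historyLaw, Measure.map_map (measurable_pi_apply _) (by fun_prop)]
  exact Measure.map_id

/-! ### The value function solves the Bellman equation -/

theorem measurable_integral_blockLaw_history {γ : Policy Y U K Z} {q : ℕ}
    {f : Z → (Fin K → X × Step Y U) → ℝ} (hf : Measurable (Function.uncurry f)) :
    Measurable fun g : Fin (q + 1) → Z =>
      ∫ d, f (g (Fin.last q)) d ∂(S.blockLaw (γ q) (g, E.enc (g (Fin.last q)))) :=
  (StronglyMeasurable.integral_kernel_prod_right
    (κ := (S.blockLaw (γ q)).comap (fun g => (g, E.enc (g (Fin.last q))))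
      (measurable_id.prodMk (E.measurable_enc.comp (measurable_pi_apply _))))
    (f := fun g d => f (g (Fin.last q)) d)
    (hf.comp (by fun_prop : Measurable fun p : (Fin (q + 1) → Z) × (Fin K → X × Step Y U) =>
      (p.1 (Fin.last q), p.2))).stronglyMeasurable).measurable

theorem abs_integral_stageCost_le (γ : Policy Y U K Z) (ν : Measure Z) [IsProbabilityMeasure ν]
    (q : ℕ) : |∫ g, S.stageCost (γ q) g (E.enc (g (Fin.last q))) ∂(S.historyLaw E γ ν q)| ≤
      S.costBound := by
  have h1 : ∀ g : Fin (q + 1) → Z, |S.stageCost (γ q) g (E.enc (g (Fin.last q)))| ≤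
      S.costBound := fun g => S.abs_integral_blockLaw_le (γ q) g _ fun d =>
    (S.abs_blockCost_le d).trans (mul_le_of_le_one_right S.costBound_nonneg
      (by linarith [S.β_pow_nonneg K]))
  simpa using norm_integral_le_of_norm_le_const (μ := S.historyLaw E γ ν q)
    (f := fun g => S.stageCost (γ q) g (E.enc (g (Fin.last q)))) (Eventually.of_forall h1)

theorem abs_integral_value_history_le (γ : Policy Y U K Z) (ν : Measure Z)
    [IsProbabilityMeasure ν] (q : ℕ) {V : Z → ℝ} (hb : ∀ z, |V z| ≤ S.costBound) :
    |∫ g, V (g (Fin.last q)) ∂(S.historyLaw E γ ν q)| ≤ S.costBound := by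
  simpa using norm_integral_le_of_norm_le_const (μ := S.historyLaw E γ ν q)
    (f := fun g => V (g (Fin.last q))) (Eventually.of_forall fun g => hb _)

theorem integral_historyLaw_zero (γ : Policy Y U K Z) (z : Z) {V : Z → ℝ} (hV : Measurable V) :
    ∫ g, V (g (Fin.last 0)) ∂(S.historyLaw E γ (Measure.dirac z) 0) = V z := by
  rw [historyLaw, integral_map (by fun_prop)
    (measurable_apply_last hV _).aestronglyMeasurable]
  exact integral_dirac' _ _ hV.stronglyMeasurable

variable [OpensMeasurableSpace (X × (∀ i, U i))]

/-- Tower property. It turns a Bellman inequality that holds at every history into a scalar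
recursion between consecutive expected values, as `le_tsum_of_le_add_mul` requires. -/
theorem integral_costToGo_history (γ : Policy Y U K Z) (ν : Measure Z) [IsProbabilityMeasure ν]
    (q : ℕ) {V : Z → ℝ} (hV : Measurable V) (hb : ∀ z, |V z| ≤ S.costBound) :
    ∫ g, ∫ d, S.costToGo E V (g (Fin.last q)) d
        ∂(S.blockLaw (γ q) (g, E.enc (g (Fin.last q)))) ∂(S.historyLaw E γ ν q) =
      ∫ g, S.stageCost (γ q) g (E.enc (g (Fin.last q))) ∂(S.historyLaw E γ ν q) +
        S.β ^ K * ∫ g, V (g (Fin.last (q + 1))) ∂(S.historyLaw E γ ν (q + 1)) := by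
  have hb1 : ∀ d : Fin K → X × Step Y U, |S.blockCost d| ≤ S.costBound := fun d =>
    (S.abs_blockCost_le d).trans (mul_le_of_le_one_right S.costBound_nonneg
      (by linarith [S.β_pow_nonneg K]))
  have hV2 : Measurable (Function.uncurry fun z d => V (S.nextState E z d)) :=
    hV.comp (S.measurable_nextState E)
  rw [S.integral_historyLaw_succ E γ ν q hV hb, ← integral_const_mul, ← integral_add]
  · refine integral_congr_ae (Eventually.of_forall fun g => ?_)
    simp only [costToGo]
    rw [integral_add (S.integrable_blockLaw _ _ _ S.measurable_blockCost hb1)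
      ((S.integrable_blockLaw _ _ _ (f := fun d => V (S.nextState E (g (Fin.last q)) d))
        (hV2.comp measurable_prodMk_left) fun d => hb _).const_mul _), integral_const_mul]
    rfl
  · exact Integrable.of_bound
      (S.measurable_integral_blockLaw_history E (f := fun _ d => S.blockCost d)
        (S.measurable_blockCost.comp measurable_snd)).aestronglyMeasurable S.costBound
      (Eventually.of_forall fun g => S.abs_integral_blockLaw_le _ _ _ hb1)
  · exact (Integrable.of_bound
      (S.measurable_integral_blockLaw_history E hV2).aestronglyMeasurable S.costBound
      (Eventually.of_forall fun g => S.abs_integral_blockLaw_le _ _ _ fun d => hb _)).const_mul _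

/-- A subsolution of the Bellman equation along a policy bounds its cost from below. -/
theorem le_cost_of_le_costToGo (hK : 0 < K) (γ : Policy Y U K Z) {V : Z → ℝ}
    (hV : Measurable V) (hb : ∀ z, |V z| ≤ S.costBound)
    (h : ∀ q (g : Fin (q + 1) → Z), V (g (Fin.last q)) ≤
      ∫ d, S.costToGo E V (g (Fin.last q)) d ∂(S.blockLaw (γ q) (g, E.enc (g (Fin.last q)))))
    (z : Z) : V z ≤ S.cost E γ z := by
  have := le_tsum_of_le_add_mul (S.β_pow_nonneg K) (S.β_pow_lt_one hK) (ε := 0)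
    (v := fun q => ∫ g, V (g (Fin.last q)) ∂(S.historyLaw E γ (Measure.dirac z) q))
    (fun q => S.abs_integral_value_history_le E γ (Measure.dirac z) q hb)
    (fun q => S.abs_integral_stageCost_le E γ (Measure.dirac z) q) fun q => by
      rw [add_zero, ← S.integral_costToGo_history E γ _ q hV hb]
      refine integral_mono ?_ ?_ (h q)
      · exact Integrable.of_bound (measurable_apply_last hV _).aestronglyMeasurable
          S.costBound (Eventually.of_forall fun g => hb _)
      · exact Integrable.of_bound (S.measurable_integral_blockLaw_history E
          (S.measurable_costToGo E hV)).aestronglyMeasurable S.costBound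
          (Eventually.of_forall fun g => S.abs_integral_blockLaw_le _ _ _
            (S.abs_costToGo_le E hb _))
  rw [S.integral_historyLaw_zero E γ z hV] at this
  simpa [cost, pow_mul] using this

/-- A near-supersolution of the Bellman equation along a policy bounds its cost from above. -/
theorem cost_le_of_costToGo_le (hK : 0 < K) (γ : Policy Y U K Z) {V : Z → ℝ}
    (hV : Measurable V) (hb : ∀ z, |V z| ≤ S.costBound) {ε : ℝ}
    (h : ∀ q (g : Fin (q + 1) → Z),
      ∫ d, S.costToGo E V (g (Fin.last q)) d ∂(S.blockLaw (γ q) (g, E.enc (g (Fin.last q)))) ≤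
        V (g (Fin.last q)) + ε)
    (z : Z) : S.cost E γ z ≤ V z + ε / (1 - S.β ^ K) := by
  -- With values and costs negated, the iteration lemma gives the upper bound.
  have := le_tsum_of_le_add_mul (S.β_pow_nonneg K) (S.β_pow_lt_one hK) (ε := ε)
    (v := fun q => -∫ g, V (g (Fin.last q)) ∂(S.historyLaw E γ (Measure.dirac z) q))
    (c := fun q => -∫ g, S.stageCost (γ q) g (E.enc (g (Fin.last q)))
      ∂(S.historyLaw E γ (Measure.dirac z) q))
    (fun q => by
      rw [abs_neg]; exact S.abs_integral_value_history_le E γ (Measure.dirac z) q hb)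
    (fun q => by
      rw [abs_neg]; exact S.abs_integral_stageCost_le E γ (Measure.dirac z) q) fun q => by
      have h1 := S.integral_costToGo_history E γ (Measure.dirac z) q hV hb
      have hi : Integrable (fun g : Fin (q + 1) → Z => V (g (Fin.last q)))
          (S.historyLaw E γ (Measure.dirac z) q) :=
        Integrable.of_bound (measurable_apply_last hV _).aestronglyMeasurable
          S.costBound (Eventually.of_forall fun g => hb _)
      have h2 := integral_mono (Integrable.of_bound (S.measurable_integral_blockLaw_history E
          (S.measurable_costToGo E hV)).aestronglyMeasurable S.costBound
          (Eventually.of_forall fun g => S.abs_integral_blockLaw_le _ _ _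
            (S.abs_costToGo_le E hb _))) (hi.add (integrable_const ε)) (h q)
      simp only [Pi.add_apply] at h2
      rw [integral_add hi (integrable_const ε)] at h2
      simp only [integral_const, probReal_univ, one_smul] at h2
      linarith
  rw [S.integral_historyLaw_zero E γ z hV] at this
  simp only [mul_neg, tsum_neg] at this
  have hc : S.cost E γ z = ∑' q, (S.β ^ K) ^ q * ∫ g, S.stageCost (γ q) g
      (E.enc (g (Fin.last q))) ∂(S.historyLaw E γ (Measure.dirac z) q) := by
    simp only [cost, pow_mul]
  linarith

variable [∀ i, Nonempty (U i)] [∀ i, Finite (U i)] [∀ i, MeasurableSingletonClass (U i)]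
  [∀ i, StandardBorelSpace (Y i)]

/-- Verification argument: a fixed point lies below the cost of every history-dependent policy, and
a stationary policy whose actions are optimal up to `ε * (1 - S.β ^ K)` accumulates a total error of
only `ε`. -/
theorem value_eq_of_bellman_eq (hK : 0 < K) {V : Z → ℝ} (hV : Measurable V)
    (hb : ∀ z, |V z| ≤ S.costBound) (hfix : S.bellman E V = V) : S.value E = V := by
  have hlow : ∀ (γ : Policy Y U K Z) z, V z ≤ S.cost E γ z := fun γ z =>
    S.le_cost_of_le_costToGo E hK γ hV hb (fun q g => by
      conv_lhs => rw [← hfix]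
      exact S.blockInf_le E.enc (S.abs_costToGo_le E hb) (γ q) g _) z
  have hρ : 0 < 1 - S.β ^ K := sub_pos.2 (S.β_pow_lt_one hK)
  have hup : ∀ ε : ℝ, 0 < ε → ∃ γ : Policy Y U K Z, ∀ z, S.cost E γ z ≤ V z + ε := by
    intro ε hε
    obtain ⟨δ, hδ⟩ := S.exists_rule_integral_le_blockInf E.measurable_enc
      (S.measurable_costToGo E hV) (S.abs_costToGo_le E hb) (mul_pos hε hρ)
    refine ⟨δ.stationary, fun z => ?_⟩
    have := S.cost_le_of_costToGo_le E hK δ.stationary hV hb (ε := ε * (1 - S.β ^ K))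
      (fun q g => by
        rw [S.blockLaw_congr (δ.stationary q) δ (h' := g (Fin.last q)) fun _ _ => rfl]
        refine (hδ _).trans_eq ?_
        exact congrArg (· + _) (congrFun hfix _)) z
    rwa [mul_div_cancel_right₀ _ hρ.ne'] at this
  have : Nonempty (Policy Y U K Z) := ⟨(hup 1 one_pos).choose⟩
  funext z
  have hbdd : BddBelow (Set.range fun γ : Policy Y U K Z => S.cost E γ z) :=
    ⟨V z, by rintro _ ⟨γ, rfl⟩; exact hlow γ z⟩
  refine le_antisymm (le_of_forall_pos_le_add fun ε hε => ?_) (le_ciInf fun γ => hlow γ z)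
  obtain ⟨γ, hγ⟩ := hup ε hε
  exact (ciInf_le hbdd γ).trans (hγ z)

/-- The value function is bounded and measurable, and it solves the Bellman equation. -/
theorem value_spec (hK : 0 < K) : Measurable (S.value E) ∧
    (∀ z, |S.value E z| ≤ S.costBound) ∧ S.bellman E (S.value E) = S.value E := by
  obtain ⟨V, hV, hb, hfix⟩ := S.exists_bellman_eq E hK
  rw [S.value_eq_of_bellman_eq E hK hV hb hfix]
  exact ⟨hV, hb, hfix⟩

end TeamModel

/-! ### Total variation -/

theorem ofReal_abs_sub_le_one {A : Type*} [MeasurableSpace A] (μ ν : Measure A)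
    [IsProbabilityMeasure μ] [IsProbabilityMeasure ν] (B : Set A) :
    ENNReal.ofReal |μ.real B - ν.real B| ≤ 1 := by
  rw [ENNReal.ofReal_le_one, abs_le]
  constructor <;> linarith [measureReal_nonneg (μ := μ) (s := B),
    measureReal_nonneg (μ := ν) (s := B), measureReal_le_one (μ := μ) (s := B),
    measureReal_le_one (μ := ν) (s := B)]

theorem tvDist_le_two {A : Type*} [MeasurableSpace A] (μ ν : Measure A)
    [IsProbabilityMeasure μ] [IsProbabilityMeasure ν] : tvDist μ ν ≤ 2 :=
  (mul_le_mul_right (iSup_le fun B : {B : Set A // MeasurableSet B} =>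
    ofReal_abs_sub_le_one μ ν B) 2).trans_eq (mul_one 2)

theorem two_mul_abs_sub_le_tvDist {A : Type*} [MeasurableSpace A] (μ ν : Measure A)
    [IsProbabilityMeasure μ] [IsProbabilityMeasure ν] {B : Set A} (hB : MeasurableSet B) :
    2 * |μ.real B - ν.real B| ≤ (tvDist μ ν).toReal := by
  rw [← ENNReal.ofReal_le_iff_le_toReal ((tvDist_le_two μ ν).trans_lt (by simp)).ne,
    ENNReal.ofReal_mul two_pos.le, ENNReal.ofReal_ofNat]
  exact mul_le_mul_right (le_iSup (fun B : {B : Set A // MeasurableSet B} =>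
    ENNReal.ofReal |μ.real B - ν.real B|) ⟨B, hB⟩) 2

/-- Integrals of a bounded function against two laws differ by at most the bound times the total
variation distance. -/
theorem abs_integral_sub_le_tvDist {A : Type*} [MeasurableSpace A] (μ ν : Measure A)
    [IsProbabilityMeasure μ] [IsProbabilityMeasure ν] {f : A → ℝ} (hf : Measurable f) {C : ℝ}
    (hC : ∀ a, |f a| ≤ C) :
    |∫ a, f a ∂μ - ∫ a, f a ∂ν| ≤ C * (tvDist μ ν).toReal := by
  have hA : Nonempty A := nonempty_of_isProbabilityMeasure μ
  have hC0 : 0 ≤ C := (abs_nonneg _).trans (hC (Classical.arbitrary A))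
  have hi : ∀ ρ : Measure A, IsProbabilityMeasure ρ → Integrable f ρ := fun ρ _ =>
    Integrable.of_bound hf.aestronglyMeasurable C (Eventually.of_forall hC)
  -- Layer cake for `f + C`, which takes values in `[0, 2C]`. The level sets have masses within half
  -- of `tvDist`, so integrating over an interval of length `2C` gives the factor `C`.
  have hlayer : ∀ ρ : Measure A, IsProbabilityMeasure ρ →
      ∫ a, f a ∂ρ + C = ∫ t in Set.Ioc 0 (2 * C), ρ.real {a | t ≤ f a + C} := fun ρ _ => by
    have := ((hi ρ inferInstance).add (integrable_const C)).integral_eq_integral_Ioc_meas_le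
      (M := 2 * C) (Eventually.of_forall fun a => by
        simpa using neg_le_iff_add_nonneg.1 (abs_le.1 (hC a)).1)
      (Eventually.of_forall fun a => by
        simp only [Pi.add_apply]; linarith [(abs_le.1 (hC a)).2])
    simp only [Pi.add_apply] at this
    rw [← this, integral_add (hi ρ inferInstance) (integrable_const C)]
    simp
  have hint : ∀ ρ : Measure A, IsProbabilityMeasure ρ →
      IntegrableOn (fun t => ρ.real {a | t ≤ f a + C}) (Set.Ioc 0 (2 * C)) := fun ρ _ => by
    refine Integrable.of_bound (C := 1) (Antitone.measurable fun s t hst =>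
      measureReal_mono fun a (ha : t ≤ f a + C) => hst.trans ha).aestronglyMeasurable
      (Eventually.of_forall fun t => ?_)
    rw [Real.norm_of_nonneg measureReal_nonneg]
    exact measureReal_le_one
  have heq : ∫ a, f a ∂μ - ∫ a, f a ∂ν = ∫ t in Set.Ioc 0 (2 * C),
      (μ.real {a | t ≤ f a + C} - ν.real {a | t ≤ f a + C}) := by
    rw [integral_sub (hint μ inferInstance) (hint ν inferInstance), ← hlayer μ inferInstance,
      ← hlayer ν inferInstance]
    ring
  rw [heq]
  have := norm_setIntegral_le_of_norm_le_const (μ := volume) (s := Set.Ioc 0 (2 * C))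
    (f := fun t => μ.real {a | t ≤ f a + C} - ν.real {a | t ≤ f a + C})
    (C := (tvDist μ ν).toReal / 2) measure_Ioc_lt_top fun t _ => by
      have := two_mul_abs_sub_le_tvDist μ ν (B := {a | t ≤ f a + C})
        (measurableSet_le measurable_const (hf.add_const C))
      rw [Real.norm_eq_abs]
      linarith
  rw [Real.norm_eq_abs, Real.volume_real_Ioc_of_le (by linarith)] at this
  linarith

/-! ### Sensitivity of the block law to the predictor -/

namespace TeamModel

variable [TopologicalSpace X] [MeasurableSpace X] [∀ i, MeasurableSpace (Y i)]
  [∀ i, TopologicalSpace (U i)] [∀ i, MeasurableSpace (U i)]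

variable (S : TeamModel X Y U) {K M : ℕ}

theorem integral_blockLaw {H : Type*} [MeasurableSpace H] (δ : DecisionRule Y U K H) (h : H)
    (z : State X Y U K M) {f : (Fin K → X × Step Y U) → ℝ} (hf : Measurable f) {C : ℝ}
    (hC : ∀ d, |f d| ≤ C) :
    ∫ d, f d ∂(S.blockLaw δ (h, z)) =
      ∫ x, ∫ q, f q.1 ∂(S.pathKernel δ K le_rfl (h, x))
        ∂(S.predictWindow z.1 z.2 : Measure X) := by
  have hm : Measurable fun p : X × ((Fin K → X × Step Y U) × X) => p.2.1 := by fun_prop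
  have hfm : Measurable fun p : X × ((Fin K → X × Step Y U) × X) => f p.2.1 := hf.comp hm
  rw [blockLaw, Kernel.map_apply _ hm, integral_map hm.aemeasurable hf.aestronglyMeasurable,
    integral_compProd (Integrable.of_bound hfm.aestronglyMeasurable C
      (Eventually.of_forall fun _ => hC _))]
  rfl

/-- Laws of the block from two states with the same rule differ by at most the total variation
distance of the laws of the current state of the system. -/
theorem abs_integral_blockLaw_sub_le_tvDist {H : Type*} [MeasurableSpace H]
    (δ : DecisionRule Y U K H) (h : H) (z z' : State X Y U K M)
    {f : (Fin K → X × Step Y U) → ℝ} (hf : Measurable f) {C : ℝ} (hC : ∀ d, |f d| ≤ C) :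
    |∫ d, f d ∂(S.blockLaw δ (h, z)) - ∫ d, f d ∂(S.blockLaw δ (h, z'))| ≤
      C * (tvDist (S.predictWindow z.1 z.2 : Measure X)
        (S.predictWindow z'.1 z'.2 : Measure X)).toReal := by
  rw [S.integral_blockLaw δ h z hf hC, S.integral_blockLaw δ h z' hf hC]
  refine abs_integral_sub_le_tvDist _ _ ?_ fun x => ?_
  · exact (StronglyMeasurable.integral_kernel_prod_right
      (κ := (S.pathKernel δ K le_rfl).comap (fun x => (h, x)) measurable_prodMk_left)
      (f := fun _ q => f q.1) (hf.comp (by fun_prop : Measurable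
        fun p : X × ((Fin K → X × Step Y U) × X) => p.2.1)).stronglyMeasurable).measurable
  · simpa using norm_integral_le_of_norm_le_const (μ := S.pathKernel δ K le_rfl (h, x))
      (f := fun q => f q.1) (C := C) (Eventually.of_forall fun q => hC q.1)

theorem trueLaw_isProbabilityMeasure (δ : DecisionRule Y U K (State X Y U K M))
    (ν : Measure (State X Y U K M)) [IsProbabilityMeasure ν] (q : ℕ) :
    IsProbabilityMeasure (S.trueLaw δ ν q) :=
  Measure.isProbabilityMeasure_map (measurable_pi_apply _).aemeasurable

/-- Provides the dominating bound for the passage `M → ∞` under the sum over periods. -/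
theorem L_le_two (πstar : ProbabilityMeasure X) (ν : Measure (State X Y U K M))
    [IsProbabilityMeasure ν] (q : ℕ) : S.L πstar ν q ≤ 2 := by
  refine iSup_le fun δ => ?_
  have := S.trueLaw_isProbabilityMeasure δ ν q
  calc _ ≤ ∫⁻ _, 2 ∂(S.trueLaw δ ν q) := lintegral_mono fun z => tvDist_le_two _ _
    _ = 2 := by simp

/-! ### Comparison of the exact and the sliding-window value functions -/

variable (πstar : ProbabilityMeasure X)

/-- Distance between the exact and the sliding-window value. -/
def gap (z : State X Y U K M) : ℝ := |S.J K M z - S.JW K M πstar z.2|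

theorem gap_nonneg (z : State X Y U K M) : 0 ≤ S.gap πstar z := abs_nonneg _

variable [OpensMeasurableSpace (X × (∀ i, U i))] [∀ i, Nonempty (U i)] [∀ i, Finite (U i)]
  [∀ i, MeasurableSingletonClass (U i)] [∀ i, StandardBorelSpace (Y i)]

theorem measurable_J (hK : 0 < K) : Measurable (S.J K M) := (S.value_spec _ hK).1

theorem measurable_JW (hK : 0 < K) : Measurable (S.JW K M πstar) := (S.value_spec _ hK).1

theorem measurable_gap (hK : 0 < K) : Measurable (S.gap (K := K) (M := M) πstar) :=
  ((S.measurable_J hK).sub ((S.measurable_JW πstar hK).comp measurable_snd)).norm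

theorem gap_le (hK : 0 < K) (z : State X Y U K M) : S.gap πstar z ≤ 2 * S.costBound := by
  have h1 := abs_le.1 ((S.value_spec (InfoState.exact X Y U K M) hK).2.1 z)
  have h2 := abs_le.1 ((S.value_spec (InfoState.sliding X Y U K M πstar) hK).2.1 z.2)
  exact abs_le.2 ⟨by unfold J JW; linarith [h1.1, h2.2], by unfold J JW; linarith [h1.2, h2.1]⟩

/-- With the same action, the right-hand sides of the two Bellman equations differ by the
mismatch of the predictors and the expected gap at the next state. -/
theorem abs_integral_costToGo_sub_le (hK : 0 < K) (δ : DecisionRule Y U K Unit)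
    (z : State X Y U K M) :
    |∫ d, S.costToGo (InfoState.exact X Y U K M) (S.J K M) z d ∂(S.blockLaw δ ((), z)) -
      ∫ d, S.costToGo (InfoState.sliding X Y U K M πstar) (S.JW K M πstar) z.2 d
        ∂(S.blockLaw δ ((), (πstar, z.2)))| ≤
      S.costBound * (tvDist (S.predictWindow z.1 z.2 : Measure X)
        (S.predictWindow πstar z.2 : Measure X)).toReal +
      S.β ^ K * ∫ d, S.gap πstar (S.nextState (InfoState.exact X Y U K M) z d)
        ∂(S.blockLaw δ ((), z)) := by
  set E := InfoState.exact X Y U K M with hE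
  set E' := InfoState.sliding X Y U K M πstar with hE'
  obtain ⟨hJ, hJb, -⟩ := S.value_spec E hK
  obtain ⟨hW, hWb, -⟩ := S.value_spec E' hK
  change Measurable (S.J K M) at hJ
  change ∀ z, |S.J K M z| ≤ _ at hJb
  change Measurable (S.JW K M πstar) at hW
  change ∀ z, |S.JW K M πstar z| ≤ _ at hWb
  have hm : Measurable (S.costToGo E (S.J K M) z) :=
    (S.measurable_costToGo E hJ).comp measurable_prodMk_left
  have hm' : Measurable (S.costToGo E' (S.JW K M πstar) z.2) :=
    (S.measurable_costToGo E' hW).comp measurable_prodMk_left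
  have hb := S.abs_costToGo_le E hJb z
  have hb' := S.abs_costToGo_le E' hWb z.2
  -- The intermediate term is the sliding-window cost-to-go under the exact block law. Changing the
  -- law costs its whole bound `S.costBound` times the distance, which is where `‖c‖ / (1 - β)` in
  -- the theorem comes from.
  have h1 := S.abs_integral_blockLaw_sub_le_tvDist δ () z (πstar, z.2) hm' hb'
  have h2 : |∫ d, S.costToGo E (S.J K M) z d ∂(S.blockLaw δ ((), z)) -
      ∫ d, S.costToGo E' (S.JW K M πstar) z.2 d ∂(S.blockLaw δ ((), z))| ≤
      S.β ^ K * ∫ d, S.gap πstar (S.nextState E z d) ∂(S.blockLaw δ ((), z)) := by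
    rw [← integral_sub (S.integrable_blockLaw δ () z hm hb)
      (S.integrable_blockLaw δ () z hm' hb'), ← integral_const_mul]
    refine (abs_integral_le_integral_abs).trans_eq (integral_congr_ae
      (Eventually.of_forall fun d => ?_))
    -- For the same record the stage costs cancel, and the next sliding window is definitionally the
    -- window of the next exact state.
    change |(_ + _ * _) - (_ + _ * _)| = _ * |_ - _|
    rw [add_sub_add_left_eq_sub, ← mul_sub, abs_mul, abs_of_nonneg (S.β_pow_nonneg K)]
    rfl
  calc _ ≤ _ := abs_sub_le _ (∫ d, S.costToGo E' (S.JW K M πstar) z.2 d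
        ∂(S.blockLaw δ ((), z))) _
    _ ≤ _ := by rw [add_comm]; exact add_le_add h1 h2

/-- Under a suitable stationary policy the gap satisfies a one-step inequality. -/
theorem exists_rule_gap_le (hK : 0 < K) {ε : ℝ} (hε : 0 < ε) :
    ∃ δ : DecisionRule Y U K (State X Y U K M), ∀ z,
      S.gap πstar z ≤ S.costBound * (tvDist (S.predictWindow z.1 z.2 : Measure X)
          (S.predictWindow πstar z.2 : Measure X)).toReal +
        S.β ^ K * ∫ d, S.gap πstar (S.nextState (InfoState.exact X Y U K M) z d)
          ∂(S.blockLaw δ (z, z)) + ε := by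
  set E := InfoState.exact X Y U K M with hE
  set E' := InfoState.sliding X Y U K M πstar with hE'
  -- Nearly minimizing the expectation of minus the gap nearly maximizes the expected gap, so one
  -- rule dominates all actions and serves both signs of the difference of values.
  let G : State X Y U K M → (Fin K → X × Step Y U) → ℝ :=
    fun z d => -S.gap πstar (S.nextState E z d)
  have hG : Measurable (Function.uncurry G) :=
    ((S.measurable_gap πstar hK).comp (S.measurable_nextState E)).neg
  have hGb : ∀ z d, |G z d| ≤ 2 * S.costBound := fun z d => by
    rw [abs_neg, abs_of_nonneg (S.gap_nonneg πstar _)]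
    exact S.gap_le πstar hK _
  obtain ⟨δ, hδ⟩ := S.exists_rule_integral_le_blockInf (e := E.enc) measurable_id hG hGb hε
  refine ⟨δ, fun z => ?_⟩
  obtain ⟨hJ, hJb, hJfix⟩ := S.value_spec E hK
  obtain ⟨hW, hWb, hWfix⟩ := S.value_spec E' hK
  change Measurable (S.J K M) at hJ
  change ∀ z, |S.J K M z| ≤ _ at hJb
  change S.bellman E (S.J K M) = S.J K M at hJfix
  change Measurable (S.JW K M πstar) at hW
  change ∀ z, |S.JW K M πstar z| ≤ _ at hWb
  change S.bellman E' (S.JW K M πstar) = S.JW K M πstar at hWfix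
  have hρ0 := S.β_pow_nonneg K
  have hρ1 := (S.β_pow_lt_one hK).le
  set t := S.costBound * (tvDist (S.predictWindow z.1 z.2 : Measure X)
    (S.predictWindow πstar z.2 : Measure X)).toReal
  have hsup : ∀ a : DecisionRule Y U K Unit,
      S.β ^ K * ∫ d, S.gap πstar (S.nextState E z d) ∂(S.blockLaw a ((), z)) ≤
        S.β ^ K * ∫ d, S.gap πstar (S.nextState E z d) ∂(S.blockLaw δ (z, z)) + ε := by
    intro a
    have h1 : S.blockInf E.enc G z ≤ ∫ d, G z d ∂(S.blockLaw a ((), z)) :=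
      S.blockInf_le E.enc hGb a () z
    have h2 : ∫ d, G z d ∂(S.blockLaw δ (z, z)) ≤ S.blockInf E.enc G z + ε := hδ z
    simp only [G, integral_neg] at h1 h2
    nlinarith
  refine abs_sub_le_iff.2 ⟨?_, ?_⟩
  · rw [sub_le_comm, ← congrFun hWfix z.2]
    refine le_ciInf fun a => ?_
    have h1 : S.J K M z ≤ _ := (congrFun hJfix z).symm.le.trans
      (S.blockInf_le E.enc (S.abs_costToGo_le E hJb) a () z)
    have h2 := (abs_le.1 (S.abs_integral_costToGo_sub_le πstar hK a z)).2
    have h3 := hsup a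
    change _ ≤ ∫ d, S.costToGo E' (S.JW K M πstar) z.2 d ∂(S.blockLaw a ((), (πstar, z.2)))
    change S.J K M z ≤ ∫ d, S.costToGo E (S.J K M) z d ∂(S.blockLaw a ((), z)) at h1
    linarith
  · rw [sub_le_comm, ← congrFun hJfix z]
    refine le_ciInf fun a => ?_
    have h1 : S.JW K M πstar z.2 ≤ _ := (congrFun hWfix z.2).symm.le.trans
      (S.blockInf_le E'.enc (S.abs_costToGo_le E' hWb) a () z.2)
    have h2 := (abs_le.1 (S.abs_integral_costToGo_sub_le πstar hK a z)).1
    have h3 := hsup a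
    change _ ≤ ∫ d, S.costToGo E (S.J K M) z d ∂(S.blockLaw a ((), z))
    change S.JW K M πstar z.2 ≤
      ∫ d, S.costToGo E' (S.JW K M πstar) z.2 d ∂(S.blockLaw a ((), (πstar, z.2))) at h1
    linarith

end TeamModel

/-- Iterating a discounted one-step inequality with a uniformly bounded remainder. -/
theorem le_sum_add_of_le_add_mul {v c : ℕ → ℝ≥0∞} {ρ ε : ℝ≥0∞} (hρ : ρ ≤ 1)
    (h : ∀ q, v q ≤ c q + ρ * v (q + 1) + ε) (n : ℕ) :
    v 0 ≤ ∑ q ∈ Finset.range n, ρ ^ q * c q + ρ ^ n * v n + n * ε := by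
  induction n with
  | zero => simp
  | succ n ih =>
    have h1 : ρ ^ n * v n ≤ ρ ^ n * c n + ρ ^ (n + 1) * v (n + 1) + ε :=
      calc ρ ^ n * v n ≤ ρ ^ n * (c n + ρ * v (n + 1) + ε) := by gcongr; exact h n
        _ = ρ ^ n * c n + ρ ^ (n + 1) * v (n + 1) + ρ ^ n * ε := by ring
        _ ≤ _ := by
          gcongr
          exact mul_le_of_le_one_left zero_le (pow_le_one₀ zero_le hρ)
    calc v 0 ≤ ∑ q ∈ Finset.range n, ρ ^ q * c q + ρ ^ n * v n + n * ε := ih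
      _ ≤ ∑ q ∈ Finset.range n, ρ ^ q * c q + (ρ ^ n * c n + ρ ^ (n + 1) * v (n + 1) + ε) +
          n * ε := by gcongr
      _ = _ := by rw [Finset.sum_range_succ]; push_cast; ring

/-! ### Summing the gap inequality over periods -/

namespace TeamModel

variable [TopologicalSpace X] [MeasurableSpace X] [∀ i, MeasurableSpace (Y i)]
  [∀ i, TopologicalSpace (U i)] [∀ i, MeasurableSpace (U i)]

variable (S : TeamModel X Y U) {K M : ℕ} (πstar : ProbabilityMeasure X)

/-- Without actions there are no policies, and the value function is zero by convention. -/
theorem value_eq_zero_of_isEmpty (hK : 0 < K) {Z : Type*} [MeasurableSpace Z]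
    (E : InfoState Z X Y U K M) (i : Fin N) [IsEmpty (U i)] (z : Z) : S.value E z = 0 := by
  have : Nonempty (Y i) := nonempty_of_isProbabilityMeasure (S.ψ i)
  have : IsEmpty (Policy Y U K Z) := ⟨fun γ => isEmptyElim
    ((γ 0).map i ⟨0, hK⟩ (fun _ => z) (fun _ => Classical.arbitrary _) fun s => s.elim0)⟩
  exact Real.iInf_of_isEmpty _

section Nonempty

variable [OpensMeasurableSpace (X × (∀ i, U i))] [∀ i, Nonempty (U i)] [∀ i, Finite (U i)]
  [∀ i, MeasurableSingletonClass (U i)] [∀ i, StandardBorelSpace (Y i)]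

/-- The near-maximizing rule is a stationary policy of the exact process, so its average mismatch in
period `q` is one of the candidates in `S.L`. The rule depends on the tolerance `ε`, so `ε → 0` is
taken for each fixed horizon `n`, and only then `n → ∞`. -/
theorem lintegral_gap_le_of_nonempty (hK : 0 < K) (ν : Measure (State X Y U K M))
    [IsProbabilityMeasure ν] :
    ∫⁻ z, ENNReal.ofReal (S.gap πstar z) ∂ν ≤
      ENNReal.ofReal S.costBound * ∑' q : ℕ, ENNReal.ofReal (S.β ^ (K * q)) * S.L πstar ν q := by
  set E := InfoState.exact X Y U K M with hE
  set ρ := ENNReal.ofReal (S.β ^ K) with hρ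
  have hρ1 : ρ < 1 := by
    rw [hρ, ENNReal.ofReal_lt_one]; exact S.β_pow_lt_one hK
  have hgm : Measurable fun z : State X Y U K M => ENNReal.ofReal (S.gap πstar z) :=
    (S.measurable_gap πstar hK).ennreal_ofReal
  set C := ENNReal.ofReal S.costBound with hC
  set A := C * ∑' q : ℕ, ENNReal.ofReal (S.β ^ (K * q)) * S.L πstar ν q with hA
  have hstep : ∀ ε : ℝ≥0, 0 < ε → ∀ n : ℕ, ∫⁻ z, ENNReal.ofReal (S.gap πstar z) ∂ν ≤
      A + ρ ^ n * ENNReal.ofReal (2 * S.costBound) + n * ε := by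
    intro ε hε n
    obtain ⟨δ, hδ⟩ := S.exists_rule_gap_le (M := M) πstar hK (NNReal.coe_pos.2 hε)
    simp only [← hE] at hδ
    have hprob := S.trueLaw_isProbabilityMeasure δ ν
    let P : State X Y U K M → ℝ≥0∞ := fun z =>
      ∫⁻ d, ENNReal.ofReal (S.gap πstar (S.nextState E z d)) ∂(S.blockLaw δ (z, z))
    have hPm : Measurable P := Measurable.lintegral_kernel_prod_right
      (κ := (S.blockLaw δ).comap (fun z => (z, z)) (by fun_prop))
      (f := fun z d => ENNReal.ofReal (S.gap πstar (S.nextState E z d)))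
      (hgm.comp (S.measurable_nextState E))
    have hpt : ∀ z, ENNReal.ofReal (S.gap πstar z) ≤
        C * tvDist (S.predictWindow z.1 z.2 : Measure X)
          (S.predictWindow πstar z.2 : Measure X) + (ρ * P z + ε) := by
      intro z
      have hnn : 0 ≤ ∫ d, S.gap πstar (S.nextState E z d) ∂(S.blockLaw δ (z, z)) :=
        integral_nonneg fun d => S.gap_nonneg πstar _
      have htv : tvDist (S.predictWindow z.1 z.2 : Measure X)
          (S.predictWindow πstar z.2 : Measure X) ≠ ∞ :=
        ((tvDist_le_two _ _).trans_lt ENNReal.ofNat_lt_top).ne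
      have hnm : Measurable fun d => S.gap πstar (S.nextState E z d) :=
        (S.measurable_gap πstar hK).comp (S.measurable_nextState_right E z)
      refine (ENNReal.ofReal_le_ofReal (hδ z)).trans_eq ?_
      rw [ENNReal.ofReal_add (add_nonneg (mul_nonneg S.costBound_nonneg ENNReal.toReal_nonneg)
          (mul_nonneg (S.β_pow_nonneg K) hnn)) ε.coe_nonneg,
        ENNReal.ofReal_add (mul_nonneg S.costBound_nonneg ENNReal.toReal_nonneg)
          (mul_nonneg (S.β_pow_nonneg K) hnn),
        ENNReal.ofReal_mul S.costBound_nonneg, ENNReal.ofReal_mul (S.β_pow_nonneg K),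
        ENNReal.ofReal_toReal htv, ENNReal.ofReal_coe_nnreal, add_assoc,
        ofReal_integral_eq_lintegral_ofReal (S.integrable_blockLaw δ z z hnm
          (C := 2 * S.costBound) fun d => by
            rw [abs_of_nonneg (S.gap_nonneg πstar _)]; exact S.gap_le πstar hK _)
          (Eventually.of_forall fun d => S.gap_nonneg πstar _)]
    have hnext : ∀ q, ∫⁻ z, P z ∂(S.trueLaw δ ν q) =
        ∫⁻ z, ENNReal.ofReal (S.gap πstar z) ∂(S.trueLaw δ ν (q + 1)) := by
      intro q
      rw [trueLaw, trueLaw, S.lintegral_stateLaw_succ _ _ _ _ hgm, stateLaw,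
        lintegral_map hPm (measurable_pi_apply (Fin.last q))]
      refine lintegral_congr fun g => ?_
      rw [S.blockLaw_congr (δ.stationary q) δ (h' := g (Fin.last q)) fun _ _ => rfl]
      rfl
    have hseq : ∀ q, ∫⁻ z, ENNReal.ofReal (S.gap πstar z) ∂(S.trueLaw δ ν q) ≤
        C * S.L πstar ν q +
          ρ * ∫⁻ z, ENNReal.ofReal (S.gap πstar z) ∂(S.trueLaw δ ν (q + 1)) + ε := by
      intro q
      have := hprob q
      refine (lintegral_mono hpt).trans ?_
      -- The sum is split using measurability of the other terms only: `tvDist` is a supremum over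
      -- uncountably many sets, and its measurability in the state is not established.
      rw [lintegral_add_right _ ((hPm.const_mul _).add_const _),
        lintegral_add_right _ measurable_const, lintegral_const_mul _ hPm, hnext q,
        lintegral_const_mul' _ _ ENNReal.ofReal_ne_top, lintegral_const, measure_univ, mul_one,
        ← add_assoc]
      gcongr
      exact le_iSup (fun δ : DecisionRule Y U K (State X Y U K M) =>
        ∫⁻ z, tvDist (S.predictWindow z.1 z.2 : Measure X)
          (S.predictWindow πstar z.2 : Measure X) ∂(S.trueLaw δ ν q)) δ
    have h0 : S.trueLaw δ ν 0 = ν := S.stateLaw_zero _ _ _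
    have hsum := le_sum_add_of_le_add_mul hρ1.le hseq n
    simp only [h0] at hsum
    refine hsum.trans ?_
    gcongr
    · rw [hA, ← ENNReal.tsum_mul_left]
      refine (Finset.sum_le_sum fun q _ => ?_).trans (ENNReal.sum_le_tsum (Finset.range n))
      rw [hρ, pow_mul, ENNReal.ofReal_pow (S.β_pow_nonneg K)]
      exact (mul_left_comm _ _ _).le
    · have := hprob n
      calc _ ≤ ∫⁻ _, ENNReal.ofReal (2 * S.costBound) ∂(S.trueLaw δ ν n) :=
            lintegral_mono fun z => ENNReal.ofReal_le_ofReal (S.gap_le πstar hK z)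
        _ = _ := by simp
  have hn : ∀ n : ℕ, ∫⁻ z, ENNReal.ofReal (S.gap πstar z) ∂ν ≤
      A + ρ ^ n * ENNReal.ofReal (2 * S.costBound) := by
    intro n
    refine ENNReal.le_of_forall_pos_le_add fun η hη _ => ?_
    -- The `n` accumulated tolerances then total at most `η`.
    refine (hstep (η / (n + 1)) (by positivity) n).trans ?_
    gcongr
    have h2 : (n : ℝ≥0) * (η / (n + 1)) ≤ η := by
      rw [mul_div_assoc', div_le_iff₀ (by positivity), mul_comm]
      gcongr
      exact le_self_add
    exact_mod_cast h2
  have hlim : Tendsto (fun n => A + ρ ^ n * ENNReal.ofReal (2 * S.costBound)) atTop (𝓝 (A + 0)) := by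
    have h1 := ENNReal.Tendsto.mul_const (b := ENNReal.ofReal (2 * S.costBound))
      (ENNReal.tendsto_pow_atTop_nhds_zero_of_lt_one hρ1) (Or.inr ENNReal.ofReal_ne_top)
    rw [zero_mul] at h1
    exact tendsto_const_nhds.add h1
  rw [add_zero] at hlim
  exact ge_of_tendsto' hlim hn

end Nonempty

variable [OpensMeasurableSpace (X × (∀ i, U i))] [∀ i, Finite (U i)]
  [∀ i, MeasurableSingletonClass (U i)] [∀ i, StandardBorelSpace (Y i)]

/-- The two value functions differ on average by at most the discounted mismatch. -/
theorem lintegral_gap_le (hK : 0 < K) (ν : Measure (State X Y U K M))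
    [IsProbabilityMeasure ν] :
    ∫⁻ z, ENNReal.ofReal (S.gap πstar z) ∂ν ≤
      ENNReal.ofReal S.costBound * ∑' q : ℕ, ENNReal.ofReal (S.β ^ (K * q)) * S.L πstar ν q := by
  by_cases h : ∀ i, Nonempty (U i)
  · exact S.lintegral_gap_le_of_nonempty πstar hK ν
  · push Not at h
    obtain ⟨i, hi⟩ := h
    have hz : ∀ z : State X Y U K M, S.gap πstar z = 0 := fun z => by
      simp only [gap, J, JW, S.value_eq_zero_of_isEmpty hK _ i, sub_self, abs_zero]
    simp [hz]

theorem measurable_value (hK : 0 < K) {Z : Type*} [MeasurableSpace Z]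
    (E : InfoState Z X Y U K M) : Measurable (S.value E) := by
  by_cases h : ∀ i, Nonempty (U i)
  · exact (S.value_spec E hK).1
  · push Not at h
    obtain ⟨i, hi⟩ := h
    rw [funext (S.value_eq_zero_of_isEmpty hK E i)]
    exact measurable_const

/-- The gap of the values vanishes on average when the predictors are stable. -/
theorem tendsto_lintegral_gap (hK : 0 < K) (ν : ∀ M, ProbabilityMeasure (State X Y U K M))
    (h : ∀ q, Tendsto (fun M => S.L πstar (ν M : Measure (State X Y U K M)) q) atTop (𝓝 0)) :
    Tendsto (fun M => ∫⁻ z, ENNReal.ofReal (S.gap πstar z) ∂(ν M : Measure (State X Y U K M)))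
      atTop (𝓝 0) := by
  have hsum : Tendsto (fun M => ∑' q : ℕ, ENNReal.ofReal (S.β ^ (K * q)) *
      S.L πstar (ν M : Measure (State X Y U K M)) q) atTop (𝓝 0) := by
    -- Dominated convergence for the counting measure on periods, with the summable bound `2 * β ^
    -- (K * q)`.
    have hdom := tendsto_lintegral_of_dominated_convergence (μ := Measure.count)
      (F := fun M (q : ℕ) => ENNReal.ofReal (S.β ^ (K * q)) *
        S.L πstar (ν M : Measure (State X Y U K M)) q) (f := fun _ => 0)
      (fun q => ENNReal.ofReal (S.β ^ (K * q)) * 2) (fun M => measurable_from_nat)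
      (fun M => Eventually.of_forall fun q => mul_le_mul_right (S.L_le_two πstar _ q) _) (by
        rw [lintegral_count, ENNReal.tsum_mul_right]
        refine ENNReal.mul_ne_top ?_ ENNReal.ofNat_ne_top
        have hs := summable_geometric_of_lt_one (S.β_pow_nonneg K) (S.β_pow_lt_one hK)
        simp only [pow_mul]
        rw [← ENNReal.ofReal_tsum_of_nonneg (fun q => pow_nonneg (S.β_pow_nonneg K) q) hs]
        exact ENNReal.ofReal_ne_top)
      (Eventually.of_forall fun q => by
        simpa using ENNReal.Tendsto.const_mul (h q) (Or.inr ENNReal.ofReal_ne_top))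
    simpa [lintegral_count] using hdom
  refine tendsto_of_tendsto_of_tendsto_of_le_of_le tendsto_const_nhds ?_ (fun _ => zero_le)
    fun M => S.lintegral_gap_le πstar hK (ν M : Measure (State X Y U K M))
  simpa using ENNReal.Tendsto.const_mul hsum (Or.inr ENNReal.ofReal_ne_top)

end TeamModel

end PeriodicSharing

end

/-! ### The main theorem -/

theorem mainTheorem1 {N : ℕ} {X : Type*} {Y U : Fin N → Type*}
    [TopologicalSpace X] [PolishSpace X] [LocallyCompactSpace X]
    [MeasurableSpace X] [BorelSpace X]
    [∀ i, TopologicalSpace (Y i)] [∀ i, PolishSpace (Y i)] [∀ i, LocallyCompactSpace (Y i)]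
    [∀ i, MeasurableSpace (Y i)] [∀ i, BorelSpace (Y i)]
    [∀ i, Finite (U i)] [∀ i, TopologicalSpace (U i)] [∀ i, DiscreteTopology (U i)]
    [∀ i, MeasurableSpace (U i)] [∀ i, BorelSpace (U i)]
    (S : PeriodicSharing.TeamModel X Y U) (K : ℕ) (hK : 0 < K) (πstar : ProbabilityMeasure X) :
    -- the value functions are measurable
    (∀ M : ℕ, S.WeakFeller K M → Measurable (S.J K M) ∧ Measurable (S.JW K M πstar)) ∧
    -- the bound from a fixed initial state
    (∀ M : ℕ, S.WeakFeller K M → ∀ z : PeriodicSharing.State X Y U K M,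
      S.PredictorsAC πstar (Measure.dirac z) →
      ENNReal.ofReal |S.J K M z - S.JW K M πstar z.2| ≤
        ENNReal.ofReal (‖S.c‖ / (1 - S.β)) *
          ∑' q : ℕ, ENNReal.ofReal (S.β ^ (K * q)) * S.L πstar (Measure.dirac z) q) ∧
    -- the bound from a random initial state
    (∀ M : ℕ, S.WeakFeller K M → ∀ ν : ProbabilityMeasure (PeriodicSharing.State X Y U K M),
      S.PredictorsAC πstar (ν : Measure (PeriodicSharing.State X Y U K M)) →
      ∫⁻ z, ENNReal.ofReal |S.J K M z - S.JW K M πstar z.2| ∂(ν : Measure (PeriodicSharing.State X Y U K M)) ≤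
        ENNReal.ofReal (‖S.c‖ / (1 - S.β)) *
          ∑' q : ℕ, ENNReal.ofReal (S.β ^ (K * q)) * S.L πstar (ν : Measure (PeriodicSharing.State X Y U K M)) q) ∧
    -- near optimality under predictor stability
    (∀ ν : ∀ M : ℕ, ProbabilityMeasure (PeriodicSharing.State X Y U K M),
      (∀ M, S.WeakFeller K M) →
      (∀ M, S.PredictorsAC πstar (ν M : Measure (PeriodicSharing.State X Y U K M))) →
      (∀ q, Tendsto (fun M => S.L πstar (ν M : Measure (PeriodicSharing.State X Y U K M)) q)
        atTop (𝓝 0)) →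
      Tendsto (fun M => ∫⁻ z, ENNReal.ofReal |S.J K M z - S.JW K M πstar z.2|
          ∂(ν M : Measure (PeriodicSharing.State X Y U K M)))
        atTop (𝓝 0)) := by
  have hm : OpensMeasurableSpace (X × ∀ i, U i) := inferInstance
  have hlin := fun (M : ℕ) (ν : Measure (PeriodicSharing.State X Y U K M))
    (_ : IsProbabilityMeasure ν) => S.lintegral_gap_le πstar hK ν
  refine ⟨fun M _ => ⟨S.measurable_value hK _, S.measurable_value hK _⟩, fun M _ z _ => ?_,
    fun M _ ν _ => hlin M ν inferInstance,
    fun ν _ _ h => S.tendsto_lintegral_gap πstar hK ν h⟩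
  have hgap : Measurable fun z : PeriodicSharing.State X Y U K M =>
      ENNReal.ofReal (S.gap πstar z) :=
    ((S.measurable_value hK _).sub
      ((S.measurable_value hK _).comp measurable_snd)).norm.ennreal_ofReal
  -- The pointwise bound is the averaged one for a Dirac initial law; measurability of the gap lets
  -- the integral be evaluated at the point.
  refine le_of_eq_of_le ?_ (hlin M (Measure.dirac z) inferInstance)
  exact (lintegral_dirac' z hgap).symm
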